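/- **Setting.** Representations are bit strings; $\rho$ maps every bit string $r$ to the Boolean function of the DNF (respectively CNF) formula over variables $1,\dots,n$ that $r$ lists term by term (respectively clause by clause), where $n$ is also determined by $r$. Let $\kappa(r)$ be the number of terms (respectively clauses) listed by $r$, and let $\mathcal R_k=\{r:\kappa(r)\le k\}$. Fix a truth value $b\in\{\text{true},\text{false}\}$. For a probability distribution $\mathcal D$ on $\{0,1\}^n$, let $\lambda_b(\mathcal D)$ be the minimum size of a set $V$ of variables such that * each assignment in the support of $\mathcal D$ sets at most one variable outside $V$ to $b$, and * each variable outside $V$ is set to $b$ by at most one assignment in the support of $\mathcal D$. A *parameterized learning algorithm* is a randomized algorithm (a program for a unit-cost random access machine with addition and truncated subtraction, fair coin flips, and an oracle call that costs $n+1$ steps). Its inputs are $n$, rationals $0<\varepsilon,\delta\le 1$, and the parameters $k=\kappa(r^*)$ and $\ell=\lambda_b(\mathcal D)$. Here $r^*$ is a hidden representation of a concept $c^*=\rho(r^*):\{0,1\}^n\to\{0,1\}$, and $\mathcal D$ is a hidden distribution on $\{0,1\}^n$. The oracle returns independent labeled samples $(x,c^*(x))$ with $x\sim\mathcal D$. The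 algorithm must always output a representation in $\mathcal R_k$ of an $n$-ary concept $h$, and with probability at least $1-\delta$ it must hold that $\Pr_{x\sim\mathcal D}[h(x)\ne c^*(x)]\le\varepsilon$. The learning problem is in $\mathsf{FPT}$-time-$\mathsf{PAC}$ if there is one such algorithm, for all $n,r^*,\mathcal D,\varepsilon,\delta$, that always halts after $O\big(f(k,\ell)\cdot p(n,|r^*|,1/\varepsilon,1/\delta)\big)$ steps and makes at most $O\big(q(n,|r^*|,1/\varepsilon,1/\delta,k,\ell)\big)$ oracle calls, where $f$ is a non-decreasing computable function and $p,q$ are non-decreasing polynomials. **Theorem.** Learning $k$-term DNF and Learning $k$-clause CNF, with distributions parameterized by $\lambda_b$, are both in $\mathsf{FPT}$-time-$\mathsf{PAC}$, for $b=\text{true}$ as well as for $b=\text{false}$. In particular this holds for DNF with $b=\text{true}$ and for CNF with $b=\text{false}$. -/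

import Mathlib

open MeasureTheory

namespace ParamPAC

/-! ### Machine model: randomized random access machines with a sample oracle -/

/-- Arithmetic expressions over numeric variables `var v` and arrays (`get a i` reads cell `i` of
array number `a`).  There is no multiplication, so unit-cost steps are realistic. -/
inductive Expr where
  | lit (c : ℕ)
  | var (v : ℕ)
  | get (a : ℕ) (i : Expr)
  | add (e₁ e₂ : Expr)
  | sub (e₁ e₂ : Expr)
  | lt (e₁ e₂ : Expr)
  | eq (e₁ e₂ : Expr)

/-- Programs.  `emit e` appends a bit to the write-only output, `flip v` stores a fair random bit
in variable `v`, and `draw a v` calls the sample oracle: the assignment is written to array `a`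
and its label to variable `v`. -/
inductive Prog where
  | skip
  | assign (v : ℕ) (e : Expr)
  | store (a : ℕ) (i e : Expr)
  | emit (e : Expr)
  | flip (v : ℕ)
  | draw (a v : ℕ)
  | seq (p q : Prog)
  | ite (e : Expr) (p q : Prog)
  | loop (e : Expr) (p : Prog)

/-- Memory contents, together with the output written so far and the numbers of oracle calls and
of coin flips made so far. -/
structure State where
  var : ℕ → ℕ
  mem : ℕ → ℕ → ℕ
  out : List Bool
  drawn : ℕ
  flipped : ℕ

/-- The initial state: the inputs are in the variables `0, 1, 2, …`, everything else is `0`. -/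
def State.init (inputs : List ℕ) : State where
  var v := inputs.getD v 0
  mem _ _ := 0
  out := []
  drawn := 0
  flipped := 0

/-- Value of an expression; subtraction is truncated, comparisons return `1` or `0`. -/
def Expr.eval (σ : State) : Expr → ℕ
  | lit c => c
  | var v => σ.var v
  | get a i => σ.mem a (i.eval σ)
  | add e₁ e₂ => e₁.eval σ + e₂.eval σ
  | sub e₁ e₂ => e₁.eval σ - e₂.eval σ
  | lt e₁ e₂ => if e₁.eval σ < e₂.eval σ then 1 else 0
  | eq e₁ e₂ => if e₁.eval σ = e₂.eval σ then 1 else 0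

/-- Number of steps for evaluating an expression: one for each node. -/
def Expr.cost : Expr → ℕ
  | lit _ => 1
  | var _ => 1
  | get _ i => i.cost + 1
  | add e₁ e₂ => e₁.cost + e₂.cost + 1
  | sub e₁ e₂ => e₁.cost + e₂.cost + 1
  | lt e₁ e₂ => e₁.cost + e₂.cost + 1
  | eq e₁ e₂ => e₁.cost + e₂.cost + 1

/-- What a run of a learning program depends on apart from its inputs: the sequence of assignments
that the oracle returns, the labelling concept and the random bits. -/
structure Env (n : ℕ) where
  sample : ℕ → (Fin n → Bool)
  label : (Fin n → Bool) → Bool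
  coin : ℕ → Bool

def State.setVar (σ : State) (v c : ℕ) : State :=
  { σ with var := Function.update σ.var v c }

def State.setMem (σ : State) (a i c : ℕ) : State :=
  { σ with mem := Function.update σ.mem a (Function.update (σ.mem a) i c) }

/-- The effect of `draw a v`: the next sample is written to the cells `0, …, n - 1` of array `a`,
its label to variable `v`. -/
def State.draw {n : ℕ} (env : Env n) (σ : State) (a v : ℕ) : State :=
  { σ with
    mem := Function.update σ.mem a fun i =>
      if h : i < n then (env.sample σ.drawn ⟨i, h⟩).toNat else σ.mem a i
    var := Function.update σ.var v (env.label (env.sample σ.drawn)).toNat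
    drawn := σ.drawn + 1 }

/-- `Exec env p σ t τ`: started in state `σ`, program `p` halts in state `τ` after `t` steps.
An oracle call is charged `n + 1` steps, the length of a labeled sample. -/
inductive Exec {n : ℕ} (env : Env n) : Prog → State → ℕ → State → Prop
  | skip (σ : State) : Exec env .skip σ 1 σ
  | assign (σ : State) (v : ℕ) (e : Expr) :
      Exec env (.assign v e) σ (e.cost + 1) (σ.setVar v (e.eval σ))
  | store (σ : State) (a : ℕ) (i e : Expr) :
      Exec env (.store a i e) σ (i.cost + e.cost + 1) (σ.setMem a (i.eval σ) (e.eval σ))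
  | emit (σ : State) (e : Expr) :
      Exec env (.emit e) σ (e.cost + 1) { σ with out := σ.out ++ [decide (e.eval σ ≠ 0)] }
  | flip (σ : State) (v : ℕ) :
      Exec env (.flip v) σ 1
        { σ.setVar v (env.coin σ.flipped).toNat with flipped := σ.flipped + 1 }
  | draw (σ : State) (a v : ℕ) : Exec env (.draw a v) σ (n + 1) (σ.draw env a v)
  | seq {p q : Prog} {σ τ υ : State} {t u : ℕ} :
      Exec env p σ t τ → Exec env q τ u υ → Exec env (.seq p q) σ (t + u) υ
  | iteTrue {e : Expr} {p q : Prog} {σ τ : State} {t : ℕ} :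
      e.eval σ ≠ 0 → Exec env p σ t τ → Exec env (.ite e p q) σ (e.cost + 1 + t) τ
  | iteFalse {e : Expr} {p q : Prog} {σ τ : State} {t : ℕ} :
      e.eval σ = 0 → Exec env q σ t τ → Exec env (.ite e p q) σ (e.cost + 1 + t) τ
  | loopDone {e : Expr} {p : Prog} {σ : State} :
      e.eval σ = 0 → Exec env (.loop e p) σ (e.cost + 1) σ
  | loopStep {e : Expr} {p : Prog} {σ τ υ : State} {t u : ℕ} :
      e.eval σ ≠ 0 → Exec env p σ t τ → Exec env (.loop e p) τ u υ →
        Exec env (.loop e p) σ (e.cost + 1 + t + u) υ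

/-- For given inputs, samples and random bits, the run of a program is unique. -/
theorem Exec.unique {n : ℕ} {env : Env n} {p : Prog} {σ τ τ' : State} {t t' : ℕ}
    (h : Exec env p σ t τ) (h' : Exec env p σ t' τ') : t = t' ∧ τ = τ' := by
  induction h generalizing t' τ' with
  | skip | assign | store | emit | flip | draw => cases h'; exact ⟨rfl, rfl⟩
  | seq _ _ ih₁ ih₂ =>
    cases h' with
    | seq a b =>
      obtain ⟨rfl, rfl⟩ := ih₁ a
      obtain ⟨rfl, rfl⟩ := ih₂ b
      exact ⟨rfl, rfl⟩
  | iteTrue he _ ih =>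
    cases h' with
    | iteTrue _ a => obtain ⟨rfl, rfl⟩ := ih a; exact ⟨rfl, rfl⟩
    | iteFalse hn _ => exact absurd hn he
  | iteFalse he _ ih =>
    cases h' with
    | iteTrue hn _ => exact absurd he hn
    | iteFalse _ a => obtain ⟨rfl, rfl⟩ := ih a; exact ⟨rfl, rfl⟩
  | loopDone he =>
    cases h' with
    | loopDone => exact ⟨rfl, rfl⟩
    | loopStep hn => exact absurd he hn
  | loopStep he _ _ ih₁ ih₂ =>
    cases h' with
    | loopDone hn => exact absurd hn he
    | loopStep _ a b =>
      obtain ⟨rfl, rfl⟩ := ih₁ a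
      obtain ⟨rfl, rfl⟩ := ih₂ b
      exact ⟨rfl, rfl⟩

/-! ### Parameterized learning problems -/

/-- Boolean functions of arbitrary finite arity. -/
abbrev Concept : Type := Σ n : ℕ, ((Fin n → Bool) → Bool)

/-- A concept class with a (surjective) representation scheme. -/
structure LearningProblem where
  concepts : Set Concept
  rho : List Bool → Concept
  range_rho : Set.range rho = concepts

/-- A learning problem with a parameterization `R` of representations and a parameterization `lam`
of distributions. -/
structure ParamLearningProblem extends LearningProblem where
  R : ℕ → Set (List Bool)
  exists_mem_R : ∀ r, ∃ k, r ∈ R k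
  kappa_computable : Computable fun r => sInf {k | r ∈ R k}
  lam : ∀ n : ℕ, PMF (Fin n → Bool) → ℕ
  lam_mono : ∀ (n : ℕ) (D D' : PMF (Fin n → Bool)), D.support ⊆ D'.support → lam n D ≤ lam n D'

/-- The least `k` with `r ∈ R k`. -/
noncomputable def ParamLearningProblem.kappa (L : ParamLearningProblem) (r : List Bool) : ℕ :=
  sInf {k | r ∈ L.R k}

/-- Resource bounds, as functions of `(n, s, 1/ε, 1/δ, k, ℓ)`. -/
abbrev Bound : Type := ℕ × ℕ × ℚ × ℚ × ℕ × ℕ → ℕ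

/-- `fpt(n, s, 1/ε, 1/δ; k, ℓ)`. -/
def Bound.IsFPT (T : Bound) : Prop :=
  ∃ f : ℕ × ℕ → ℕ, Computable f ∧ Monotone f ∧ ∃ p : MvPolynomial (Fin 4) ℕ,
    ∀ (n s : ℕ) (x y : ℚ) (k l : ℕ), 1 ≤ x → 1 ≤ y →
      (T (n, s, x, y, k, l) : ℚ) ≤ f (k, l) * MvPolynomial.aeval ![(n : ℚ), (s : ℚ), x, y] p

/-- `poly(n, s, 1/ε, 1/δ, k, ℓ)`. -/
def Bound.IsPoly (S : Bound) : Prop :=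
  ∃ p : MvPolynomial (Fin 6) ℕ, ∀ (n s : ℕ) (x y : ℚ) (k l : ℕ), 1 ≤ x → 1 ≤ y →
    (S (n, s, x, y, k, l) : ℚ) ≤ MvPolynomial.aeval ![(n : ℚ), (s : ℚ), x, y, (k : ℚ), (l : ℚ)] p

/-- The law of an infinite sequence of independent samples from `D`, together with an independent
infinite sequence of fair random bits. -/
noncomputable def runLaw {n : ℕ} (D : PMF (Fin n → Bool)) :
    Measure ((ℕ → (Fin n → Bool)) × (ℕ → Bool)) :=
  (Measure.infinitePi fun _ : ℕ => D.toMeasure).prod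
    (Measure.infinitePi fun _ : ℕ => (PMF.uniformOfFintype Bool).toMeasure)

/-- `A` is a parameterized PAC learning algorithm for `L` that runs in time `O(T)` and queries the
oracle `O(S)` times.  Its inputs are `n`, `k`, `ℓ` and the numerators and denominators of `ε` and
`δ`.  Whatever samples from the support of the distribution and whatever random bits it receives,
it halts within these bounds and outputs a hypothesis in `R k` (on the right number of variables);
with probability at least `1 - δ`, the generalization error of its output is at most `ε`. -/
def IsPACLearner (L : ParamLearningProblem) (A : Prog) (T S : Bound) : Prop :=
  ∃ C : ℕ, ∀ (n : ℕ) (c : (Fin n → Bool) → Bool) (r : List Bool), L.rho r = ⟨n, c⟩ →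
    ∀ (D : PMF (Fin n → Bool)) (ε δ : ℚ), 0 < ε → ε ≤ 1 → 0 < δ → δ ≤ 1 →
    ∀ k l : ℕ, k = L.kappa r → l = L.lam n D →
      let start := State.init [n, k, l, ε.num.toNat, ε.den, δ.num.toNat, δ.den]
      let args := (n, r.length, 1 / ε, 1 / δ, k, l)
      (∀ (x : ℕ → (Fin n → Bool)) (coin : ℕ → Bool), (∀ i, x i ∈ D.support) →
        ∃ (t : ℕ) (σ : State), Exec ⟨x, c, coin⟩ A start t σ ∧
          t ≤ C * T args ∧ σ.drawn ≤ C * S args ∧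
          σ.out ∈ L.R k ∧ (L.rho σ.out).1 = n) ∧
      1 - (δ : ℝ) ≤ (runLaw D).real
        {ω | ∃ (t : ℕ) (σ : State), Exec ⟨ω.1, c, ω.2⟩ A start t σ ∧
          ∃ h : (Fin n → Bool) → Bool, L.rho σ.out = ⟨n, h⟩ ∧
            D.toMeasure.real {x | h x ≠ c x} ≤ (ε : ℝ)}

/-- The class of parameterized learning problems that are `(T, S)`-PAC learnable for some
`T ∈ fpt(n, s, 1/ε, 1/δ; k, ℓ)` and `S ∈ poly(n, s, 1/ε, 1/δ, k, ℓ)`. -/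
def FPTPACTime : Set ParamLearningProblem :=
  {L | ∃ T S : Bound, Monotone T ∧ Monotone S ∧ T.IsFPT ∧ S.IsPoly ∧
    ∃ A : Prog, IsPACLearner L A T S}

/-! ### DNF and CNF formulas -/

/-- A literal on `n` variables: `(i, true)` is the variable `i`, `(i, false)` its negation. -/
abbrev Literal (n : ℕ) : Type := Fin n × Bool

/-- A list of sets of literals, to be read as a list of terms (DNF) or of clauses (CNF). -/
abbrev Formula (n : ℕ) : Type := List (Finset (Literal n))

def evalDNF {n : ℕ} (φ : Formula n) (x : Fin n → Bool) : Bool :=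
  decide (∃ P ∈ φ, ∀ l ∈ P, x l.1 = l.2)

def evalCNF {n : ℕ} (φ : Formula n) (x : Fin n → Bool) : Bool :=
  decide (∀ P ∈ φ, ∃ l ∈ P, x l.1 = l.2)

/-! A formula with `m` terms (clauses) on `n` variables is written as `1ⁿ 0 1ᵐ 0` followed by the
`m × 2n` incidence matrix of terms and literals, row by row.  Missing matrix entries count as `0`,
surplus bits are ignored; so every bit string represents a formula. -/

/-- Number of ones before the first zero. -/
def leadingOnes (r : List Bool) : ℕ := r.findIdx (fun b => !b)

/-- Number of variables of the formula represented by `r`. -/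
def numVars (r : List Bool) : ℕ := leadingOnes r

/-- Number of terms (clauses) of the formula represented by `r`. -/
def numTerms (r : List Bool) : ℕ := leadingOnes (r.drop (numVars r + 1))

/-- The matrix part of `r`. -/
def matrixPart (r : List Bool) : List Bool :=
  (r.drop (numVars r + 1)).drop (numTerms r + 1)

/-- The formula represented by `r`. -/
def decodeFormula (r : List Bool) : Formula (numVars r) :=
  List.ofFn fun j : Fin (numTerms r) =>
    Finset.univ.filter fun l : Literal (numVars r) =>
      (matrixPart r).getD (2 * (numVars r * j + l.1) + l.2.toNat) false = true

theorem leadingOnes_replicate (n : ℕ) (r : List Bool) :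
    leadingOnes (List.replicate n true ++ false :: r) = n := by
  induction n with
  | zero => simp [leadingOnes, List.findIdx_cons]
  | succ n ih =>
    simp only [leadingOnes, List.replicate_succ, List.cons_append, List.findIdx_cons] at ih ⊢
    simp [ih]

theorem drop_replicate (n : ℕ) (r : List Bool) :
    (List.replicate n true ++ false :: r).drop (n + 1) = r := by
  induction n with
  | zero => rfl
  | succ n ih => simpa [List.replicate_succ] using ih

/-- Every formula has a representation with the same number of terms. -/
theorem exists_decodeFormula {n : ℕ} (φ : Formula n) :
    ∃ r : List Bool, numTerms r = φ.length ∧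
      (⟨numVars r, decodeFormula r⟩ : Σ n, Formula n) = ⟨n, φ⟩ := by
  classical
  let bit : ℕ → Bool := fun q => decide (∃ (j : Fin φ.length) (l : Literal n),
    q = 2 * (n * j + l.1) + l.2.toNat ∧ l ∈ φ[j])
  let body := (List.range (2 * (n * φ.length))).map bit
  let tail := List.replicate φ.length true ++ false :: body
  let r := List.replicate n true ++ false :: tail
  have hn : numVars r = n := leadingOnes_replicate n tail
  have hd : r.drop (n + 1) = tail := drop_replicate n tail
  have hm : numTerms r = φ.length := by
    unfold numTerms; rw [hn, hd]; exact leadingOnes_replicate _ _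
  have hb : matrixPart r = body := by
    unfold matrixPart; rw [hn, hm, hd]; exact drop_replicate _ _
  have key : ∀ (j : Fin φ.length) (l : Literal n),
      body.getD (2 * (n * j + l.1) + l.2.toNat) false = true ↔ l ∈ φ[j] := by
    intro j l
    have hl := l.1.2
    have hb2 : l.2.toNat < 2 := Bool.toNat_lt _
    have hj : n * (j : ℕ) + n ≤ n * φ.length := by
      have := Nat.mul_le_mul_left n (Nat.succ_le_of_lt j.2)
      rwa [Nat.mul_succ] at this
    have hlt : 2 * (n * j + l.1) + l.2.toNat < 2 * (n * φ.length) := by omega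
    rw [List.getD_eq_getElem _ _ (by simpa [body] using hlt)]
    simp only [body, List.getElem_map, List.getElem_range, bit, decide_eq_true_eq]
    constructor
    · rintro ⟨j', l', he, hmem⟩
      have hl' := l'.1.2
      have hb2' : l'.2.toNat < 2 := Bool.toNat_lt _
      have h1 : l.2.toNat = l'.2.toNat := by omega
      have h2 : n * (j : ℕ) + l.1 = n * j' + l'.1 := by omega
      have h3 : (j : ℕ) = j' := by
        have e1 : (n * (j : ℕ) + l.1) / n = j := by
          rw [Nat.mul_add_div (by omega), Nat.div_eq_of_lt hl, add_zero]
        have e2 : (n * (j' : ℕ) + l'.1) / n = j' := by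
          rw [Nat.mul_add_div (by omega), Nat.div_eq_of_lt hl', add_zero]
        rw [← e1, h2, e2]
      have h4 : (l.1 : ℕ) = l'.1 := by rw [h3] at h2; omega
      have hinj : ∀ a b : Bool, a.toNat = b.toNat → a = b := by decide
      have h5 : l = l' := Prod.ext (Fin.ext h4) (hinj _ _ h1)
      have h6 : j = j' := Fin.ext h3
      rw [h5, h6]; exact hmem
    · intro hmem; exact ⟨j, l, rfl, hmem⟩
  refine ⟨r, hm, ?_⟩
  have gen : ∀ (N M : ℕ) (B : List Bool), N = n → M = φ.length → B = body →
      (⟨N, List.ofFn fun j : Fin M => Finset.univ.filter fun l : Literal N =>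
        B.getD (2 * (N * j + l.1) + l.2.toNat) false = true⟩ : Σ n, Formula n) = ⟨n, φ⟩ := by
    rintro N M B rfl rfl rfl
    congr 1
    refine Eq.trans ?_ (List.ofFn_getElem (xs := φ))
    congr 1
    funext j
    ext l
    simp only [Finset.mem_filter, Finset.mem_univ, true_and]
    exact key j l
  exact gen _ _ _ hn hm hb

theorem numTerms_computable : Computable numTerms := by
  have h : Primrec leadingOnes :=
    Primrec.list_findIdx Primrec.id (Primrec.not.comp Primrec.snd).to₂
  exact (h.comp (Primrec.list_drop.comp (Primrec.succ.comp h) Primrec.id)).to_comp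

/-! ### The parameter: few assignments outside of a small variable set -/

/-- Each assignment in `X` sets at most one variable outside of `V` to `b`, and each variable
outside of `V` is set to `b` by at most one assignment in `X`. -/
def FewOutside (b : Bool) {n : ℕ} (X : Set (Fin n → Bool)) (V : Finset (Fin n)) : Prop :=
  (∀ x ∈ X, ∀ i ∉ V, ∀ j ∉ V, x i = b → x j = b → i = j) ∧
  (∀ i ∉ V, ∀ x ∈ X, ∀ y ∈ X, x i = b → y i = b → x = y)

/-- The minimum size of a set `V` of variables such that the support of `D` satisfies
`FewOutside b`. -/
noncomputable def fewOutsideParam (b : Bool) (n : ℕ) (D : PMF (Fin n → Bool)) : ℕ :=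
  sInf {s | ∃ V : Finset (Fin n), V.card = s ∧ FewOutside b D.support V}

theorem fewOutsideParam_mono (b : Bool) (n : ℕ) (D D' : PMF (Fin n → Bool))
    (h : D.support ⊆ D'.support) : fewOutsideParam b n D ≤ fewOutsideParam b n D' := by
  have hne : {s | ∃ V : Finset (Fin n), V.card = s ∧ FewOutside b D'.support V}.Nonempty :=
    ⟨_, Finset.univ, rfl, fun _ _ i hi => absurd (Finset.mem_univ i) hi,
      fun i hi => absurd (Finset.mem_univ i) hi⟩
  obtain ⟨V, hV, h1, h2⟩ := Nat.sInf_mem hne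
  exact Nat.sInf_le ⟨V, hV, fun x hx => h1 x (h hx),
    fun i hi x hx y hy => h2 i hi x (h hx) y (h hy)⟩

/-- Learning formulas with few terms (clauses), where `ev` says how formulas are evaluated:
`R k` consists of the representations of formulas with at most `k` terms (clauses), and
distributions are parameterized by `fewOutsideParam b`. -/
noncomputable def learningFormulas (ev : ∀ {n : ℕ}, Formula n → (Fin n → Bool) → Bool)
    (b : Bool) : ParamLearningProblem where
  concepts := {c | ∃ φ : Formula c.1, c.2 = ev φ}
  rho r := ⟨numVars r, ev (decodeFormula r)⟩
  range_rho := by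
    ext c
    constructor
    · rintro ⟨r, rfl⟩
      exact ⟨decodeFormula r, rfl⟩
    · obtain ⟨n, c⟩ := c
      rintro ⟨φ, hφ⟩
      have hc : c = @ev n φ := hφ
      obtain ⟨r, -, hr⟩ := exists_decodeFormula (n := n) φ
      refine ⟨r, (congrArg (fun ψ : Σ n, Formula n => (⟨ψ.1, ev ψ.2⟩ : Concept)) hr).trans ?_⟩
      rw [hc]
  R k := {r | numTerms r ≤ k}
  exists_mem_R r := ⟨numTerms r, le_refl (numTerms r)⟩
  kappa_computable := by
    refine numTerms_computable.of_eq fun r => ?_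
    exact (csInf_Ici (a := numTerms r)).symm
  lam := fewOutsideParam b
  lam_mono := fewOutsideParam_mono b

/-- Learning `k`-term DNF: the concepts are given by DNF formulas, `k` is the number of terms. -/
noncomputable def learningTermDNF (b : Bool) : ParamLearningProblem := learningFormulas evalDNF b

/-- Learning `k`-clause CNF: the concepts are given by CNF formulas, `k` is the number of
clauses. -/
noncomputable def learningClauseCNF (b : Bool) : ParamLearningProblem := learningFormulas evalCNF b

end ParamPAC

/-!
Up to negation of inputs and labels, all four cases are one problem. Write `z i = 1` if the
assignment gives variable `i` the value `b`, and call a sample positive if a DNF formula is true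
at it, respectively if a CNF formula is false at it. A term (clause) then becomes a set of literals
over `z`, and a sample is positive exactly if some row of the matrix of the formula covers it, that
is, contains no literal that the sample falsifies (`evalForm_decodeFormula`, `sign_lookup`). A
learner that always finds at most `k` rows consistent with `m` samples is a PAC learner as soon as
`m` is large enough for a union bound over the at most `(4 ^ n + 1) ^ k` formulas
(`one_sub_le_runLaw`), and such an `m` is polynomial in `n`, `k`, `1/ε` and `1/δ`.

It remains to find consistent rows in fpt time. Call a column shared if two distinct samples set it.
Every set `V` as in the definition of the parameter `ℓ` contains all shared columns, so there are at
most `ℓ` of them (`count_shared_le`); each other column is set by at most one sample vector. Hence a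
row of a consistent formula which has a positive literal on a column that is not shared covers at
most one sample vector, and may be replaced by the full description of that vector. A row without
such literals may be given, outside of the shared columns, the negative literals of exactly those
columns that some negative sample sets: this excludes every negative sample that the row excluded
there, and it excludes no positive one, because the columns are not shared. So the only choices are
the number `a ≤ k` of rows of the second kind and the at most `2 * ℓ` bits of each of them on the
shared columns.
The algorithm tries all `a` and all `4 ^ (k * ℓ)` codes for these bits, and adds a full row for each
positive sample that is not yet covered; `exists_lucky` and `Greedy.consistent` show that one of the
attempts is successful.

The program is verified with a calculus of total correctness (`Runs`). Running times are read off
the syntax: if no loop makes more than `g` iterations, the time is at most `Prog.timeBound`, which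
is polynomial in `n + g`; and here `g` may be chosen as a polynomial in the inputs plus
`4 ^ (k * ℓ)`.
-/

namespace ParamPAC

/-! ### Total correctness with syntactic time bounds -/

/-- The number of steps that a program takes at most, if each of its loops is left after at most
`g` iterations and a sample has `n` bits. -/
def Prog.timeBound (n g : ℕ) : Prog → ℕ
  | skip => 1
  | assign _ e => e.cost + 1
  | store _ i e => i.cost + e.cost + 1
  | emit e => e.cost + 1
  | flip _ => 1
  | draw _ _ => n + 1
  | seq p q => p.timeBound n g + q.timeBound n g
  | ite e p q => e.cost + 1 + (p.timeBound n g + q.timeBound n g)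
  | loop e p => g * (e.cost + 1 + p.timeBound n g) + (e.cost + 1)

/-- The number of nodes of a program, expressions included. -/
def Prog.size : Prog → ℕ
  | skip => 1
  | assign _ e => e.cost + 1
  | store _ i e => i.cost + e.cost + 1
  | emit e => e.cost + 1
  | flip _ => 1
  | draw _ _ => 1
  | seq p q => p.size + q.size
  | ite e p q => e.cost + 1 + (p.size + q.size)
  | loop e p => e.cost + 1 + p.size + (e.cost + 1)

/-- The nesting depth of a program, which is the degree of `Prog.timeBound` as a polynomial. -/
def Prog.depth : Prog → ℕ
  | seq p q => max p.depth q.depth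
  | ite _ p q => max p.depth q.depth
  | loop _ p => p.depth + 1
  | _ => 1

theorem Prog.timeBound_le (n g : ℕ) (p : Prog) :
    p.timeBound n g ≤ p.size * (n + g + 1) ^ p.depth := by
  have one (d : ℕ) : 1 ≤ (n + g + 1) ^ d := Nat.one_le_pow _ _ (by omega)
  have mono {d d' : ℕ} (h : d ≤ d') : (n + g + 1) ^ d ≤ (n + g + 1) ^ d' :=
    Nat.pow_le_pow_right (by omega) h
  induction p with
  | skip | assign | store | emit | flip => exact Nat.le_mul_of_pos_right _ (one _)
  | draw => simp only [timeBound, size, depth, pow_one]; omega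
  | seq p q ihp ihq =>
    have hp := ihp.trans (Nat.mul_le_mul_left _ (mono (le_max_left p.depth q.depth)))
    have hq := ihq.trans (Nat.mul_le_mul_left _ (mono (le_max_right p.depth q.depth)))
    simp only [timeBound, size, depth, add_mul]
    omega
  | ite e p q ihp ihq =>
    have hp := ihp.trans (Nat.mul_le_mul_left _ (mono (le_max_left p.depth q.depth)))
    have hq := ihq.trans (Nat.mul_le_mul_left _ (mono (le_max_right p.depth q.depth)))
    have he := Nat.le_mul_of_pos_right (e.cost + 1) (one (max p.depth q.depth))
    simp only [timeBound, size, depth, add_mul _ _ ((n + g + 1) ^ _)] at he ⊢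
    omega
  | loop e p ih =>
    have he := Nat.le_mul_of_pos_right (e.cost + 1) (one p.depth)
    have he' := Nat.le_mul_of_pos_right (e.cost + 1) (one (p.depth + 1))
    calc g * (e.cost + 1 + p.timeBound n g) + (e.cost + 1)
        ≤ (n + g + 1) * ((e.cost + 1) * (n + g + 1) ^ p.depth + p.size * (n + g + 1) ^ p.depth)
            + (e.cost + 1) * (n + g + 1) ^ (p.depth + 1) := by
          gcongr
          omega
      _ = _ := by simp only [size, depth]; ring

/-- `p.modVar v`: the program `p` may write to variable `v`. -/
def Prog.modVar (v : ℕ) : Prog → Bool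
  | assign u _ => u == v
  | flip u => u == v
  | draw _ u => u == v
  | seq p q => p.modVar v || q.modVar v
  | ite _ p q => p.modVar v || q.modVar v
  | loop _ p => p.modVar v
  | _ => false

/-- `p.modMem a`: the program `p` may write to array `a`. -/
def Prog.modMem (a : ℕ) : Prog → Bool
  | store b _ _ => b == a
  | draw b _ => b == a
  | seq p q => p.modMem a || q.modMem a
  | ite _ p q => p.modMem a || q.modMem a
  | loop _ p => p.modMem a
  | _ => false

/-- The program may write output. -/
def Prog.emits : Prog → Bool
  | emit _ => true
  | seq p q => p.emits || q.emits
  | ite _ p q => p.emits || q.emits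
  | loop _ p => p.emits
  | _ => false

/-- The program may call the sample oracle. -/
def Prog.draws : Prog → Bool
  | draw _ _ => true
  | seq p q => p.draws || q.draws
  | ite _ p q => p.draws || q.draws
  | loop _ p => p.draws
  | _ => false

/-- The two states agree on everything that `p` cannot change. -/
structure Frame (p : Prog) (σ τ : State) : Prop where
  var : ∀ v, p.modVar v = false → τ.var v = σ.var v
  mem : ∀ a, p.modMem a = false → τ.mem a = σ.mem a
  out : p.emits = false → τ.out = σ.out
  drawn : p.draws = false → τ.drawn = σ.drawn

namespace Frame

variable {p q : Prog} {σ τ υ : State}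

theorem refl (p : Prog) (σ : State) : Frame p σ σ :=
  ⟨fun _ _ => rfl, fun _ _ => rfl, fun _ => rfl, fun _ => rfl⟩

theorem trans (h : Frame p σ τ) (h' : Frame p τ υ) : Frame p σ υ :=
  ⟨fun v hv => (h'.var v hv).trans (h.var v hv), fun a ha => (h'.mem a ha).trans (h.mem a ha),
    fun ho => (h'.out ho).trans (h.out ho), fun hd => (h'.drawn hd).trans (h.drawn hd)⟩

theorem mono (h : Frame p σ τ) (hv : ∀ v, q.modVar v = false → p.modVar v = false)
    (ha : ∀ a, q.modMem a = false → p.modMem a = false)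
    (ho : q.emits = false → p.emits = false) (hd : q.draws = false → p.draws = false) :
    Frame q σ τ :=
  ⟨fun v h' => h.var v (hv v h'), fun a h' => h.mem a (ha a h'), fun h' => h.out (ho h'),
    fun h' => h.drawn (hd h')⟩

end Frame

@[simp] theorem State.var_setVar (σ : State) (v c u : ℕ) :
    (σ.setVar v c).var u = if u = v then c else σ.var u := by
  simp [State.setVar, Function.update_apply]

@[simp] theorem State.mem_setVar (σ : State) (v c : ℕ) : (σ.setVar v c).mem = σ.mem := rfl

@[simp] theorem State.out_setVar (σ : State) (v c : ℕ) : (σ.setVar v c).out = σ.out := rfl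

@[simp] theorem State.drawn_setVar (σ : State) (v c : ℕ) : (σ.setVar v c).drawn = σ.drawn := rfl

@[simp] theorem State.var_setMem (σ : State) (a i c : ℕ) : (σ.setMem a i c).var = σ.var := rfl

@[simp] theorem State.drawn_setMem (σ : State) (a i c : ℕ) : (σ.setMem a i c).drawn = σ.drawn := rfl

@[simp] theorem State.mem_setMem (σ : State) (a i c b : ℕ) :
    (σ.setMem a i c).mem b = if b = a then Function.update (σ.mem a) i c else σ.mem b := by
  simp [State.setMem, Function.update_apply]

section TotalCorrectness

variable {n : ℕ} {env : Env n}

/-- A run changes only what the syntax of the program allows it to change. -/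
theorem Exec.frame {p : Prog} {σ τ : State} {t : ℕ} (h : Exec env p σ t τ) : Frame p σ τ := by
  induction h with
  | skip σ => exact Frame.refl _ _
  | assign σ v e =>
    refine ⟨fun u hu => ?_, fun _ _ => rfl, fun _ => rfl, fun _ => rfl⟩
    have : u ≠ v := by rintro rfl; simp [Prog.modVar] at hu
    simp [State.var_setVar, this]
  | store σ a i e =>
    refine ⟨fun _ _ => rfl, fun b hb => ?_, fun _ => rfl, fun _ => rfl⟩
    have : b ≠ a := by rintro rfl; simp [Prog.modMem] at hb
    simp [State.mem_setMem, this]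
  | emit σ e => exact ⟨fun _ _ => rfl, fun _ _ => rfl, fun h => by simp [Prog.emits] at h,
      fun _ => rfl⟩
  | flip σ v =>
    refine ⟨fun u hu => ?_, fun _ _ => rfl, fun _ => rfl, fun _ => rfl⟩
    have : u ≠ v := by rintro rfl; simp [Prog.modVar] at hu
    simp [State.var_setVar, this]
  | draw σ a v =>
    refine ⟨fun u hu => ?_, fun b hb => ?_, fun _ => rfl, fun h => by simp [Prog.draws] at h⟩
    · have : u ≠ v := by rintro rfl; simp [Prog.modVar] at hu
      simp [State.draw, this]
    · have : b ≠ a := by rintro rfl; simp [Prog.modMem] at hb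
      simp [State.draw, this]
  | seq _ _ ih₁ ih₂ =>
    refine (ih₁.mono ?_ ?_ ?_ ?_).trans (ih₂.mono ?_ ?_ ?_ ?_) <;>
      simp +contextual [Prog.modVar, Prog.modMem, Prog.emits, Prog.draws]
  | iteTrue _ _ ih =>
    refine ih.mono ?_ ?_ ?_ ?_ <;>
      simp +contextual [Prog.modVar, Prog.modMem, Prog.emits, Prog.draws]
  | iteFalse _ _ ih =>
    refine ih.mono ?_ ?_ ?_ ?_ <;>
      simp +contextual [Prog.modVar, Prog.modMem, Prog.emits, Prog.draws]
  | loopDone => exact Frame.refl _ _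
  | loopStep _ _ _ ih₁ ih₂ =>
    refine (ih₁.mono ?_ ?_ ?_ ?_).trans ih₂ <;>
      simp +contextual [Prog.modVar, Prog.modMem, Prog.emits, Prog.draws]

/-- Total correctness: started in `σ`, the program halts within the time that `Prog.timeBound`
allows for loops of at most `g` iterations, in a state that satisfies `Q`. -/
def Runs (env : Env n) (g : ℕ) (p : Prog) (σ : State) (Q : State → Prop) : Prop :=
  ∃ (t : ℕ) (τ : State), Exec env p σ t τ ∧ t ≤ p.timeBound n g ∧ Q τ

namespace Runs

variable {g : ℕ} {p q : Prog} {σ : State} {Q Q' : State → Prop}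

/-- The rule of consequence; what `p` cannot change may be used for the new postcondition. -/
theorem mono (h : Runs env g p σ Q) (h' : ∀ τ, Frame p σ τ → Q τ → Q' τ) :
    Runs env g p σ Q' := by
  obtain ⟨t, τ, he, ht, hq⟩ := h
  exact ⟨t, τ, he, ht, h' τ he.frame hq⟩

theorem skip (h : Q σ) : Runs env g .skip σ Q := ⟨_, _, .skip σ, le_rfl, h⟩

theorem assign {v : ℕ} {e : Expr} (h : Q (σ.setVar v (e.eval σ))) :
    Runs env g (.assign v e) σ Q := ⟨_, _, .assign σ v e, le_rfl, h⟩

theorem store {a : ℕ} {i e : Expr} (h : Q (σ.setMem a (i.eval σ) (e.eval σ))) :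
    Runs env g (.store a i e) σ Q := ⟨_, _, .store σ a i e, le_rfl, h⟩

theorem emit {e : Expr} (h : Q { σ with out := σ.out ++ [decide (e.eval σ ≠ 0)] }) :
    Runs env g (.emit e) σ Q := ⟨_, _, .emit σ e, le_rfl, h⟩

theorem draw {a v : ℕ} (h : Q (σ.draw env a v)) : Runs env g (.draw a v) σ Q :=
  ⟨_, _, .draw σ a v, le_rfl, h⟩

theorem seq (h : Runs env g p σ fun τ => Runs env g q τ Q) : Runs env g (.seq p q) σ Q := by
  obtain ⟨t, τ, he, ht, u, υ, he', hu, hq⟩ := h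
  exact ⟨_, _, .seq he he', Nat.add_le_add ht hu, hq⟩

theorem ite {e : Expr} (hp : e.eval σ ≠ 0 → Runs env g p σ Q)
    (hq : e.eval σ = 0 → Runs env g q σ Q) : Runs env g (.ite e p q) σ Q := by
  by_cases h : e.eval σ = 0
  · obtain ⟨t, τ, he, ht, hQ⟩ := hq h
    exact ⟨_, _, .iteFalse h he, by simp only [Prog.timeBound]; omega, hQ⟩
  · obtain ⟨t, τ, he, ht, hQ⟩ := hp h
    exact ⟨_, _, .iteTrue h he, by simp only [Prog.timeBound]; omega, hQ⟩

/-- Loops that are left after exactly `N` iterations. -/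
theorem loop {e : Expr} (I : ℕ → State → Prop) (N : ℕ) (hN : N ≤ g) (h0 : I 0 σ)
    (step : ∀ i < N, ∀ τ, I i τ → e.eval τ ≠ 0 ∧ Runs env g p τ (I (i + 1)))
    (done : ∀ τ, I N τ → e.eval τ = 0) : Runs env g (.loop e p) σ (I N) := by
  have key : ∀ r ≤ N, ∀ τ, I (N - r) τ → ∃ t υ, Exec env (.loop e p) τ t υ ∧
      t ≤ r * (e.cost + 1 + p.timeBound n g) + (e.cost + 1) ∧ I N υ := by
    intro r
    induction r with
    | zero => exact fun _ τ h => ⟨_, _, .loopDone (done τ h), by omega, h⟩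
    | succ r ih =>
      intro hr τ h
      obtain ⟨he, t, υ, hx, ht, hI⟩ := step _ (by omega) τ h
      rw [show N - (r + 1) + 1 = N - r by omega] at hI
      obtain ⟨t', υ', hx', ht', hI'⟩ := ih (by omega) υ hI
      refine ⟨_, _, .loopStep he hx hx', ?_, hI'⟩
      rw [add_mul, one_mul]
      omega
  obtain ⟨t, υ, hx, ht, hI⟩ := key N le_rfl σ (by simpa using h0)
  refine ⟨t, υ, hx, ht.trans ?_, hI⟩
  exact Nat.add_le_add_right (Nat.mul_le_mul_right _ hN) _

end Runs

/-- `for v := 0 to w - 1 do p`, where `v` and `w` are variables that `p` does not change. -/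
def Prog.forUp (v w : ℕ) (p : Prog) : Prog :=
  .seq (.assign v (.lit 0))
    (.loop (.lt (.var v) (.var w)) (.seq p (.assign v (.add (.var v) (.lit 1)))))

theorem Prog.modVar_forUp (v w u : ℕ) (p : Prog) :
    (Prog.forUp v w p).modVar u = (v == u || p.modVar u) := by
  simp only [forUp, modVar]
  cases v == u <;> simp

theorem Frame.of_body {v w : ℕ} {p : Prog} {σ τ : State} (h : Frame p σ τ) :
    Frame (.forUp v w p) σ τ :=
  h.mono (fun u => by simp [Prog.modVar_forUp]) (by simp [Prog.forUp, Prog.modMem])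
    (by simp [Prog.forUp, Prog.emits]) (by simp [Prog.forUp, Prog.draws])

theorem Frame.setVar {v w c : ℕ} {p : Prog} {σ τ : State} (h : Frame (.forUp v w p) σ τ) :
    Frame (.forUp v w p) σ (τ.setVar v c) := by
  refine ⟨fun u hu => ?_, h.mem, h.out, h.drawn⟩
  have hne : u ≠ v := by
    rintro rfl
    simp [Prog.modVar_forUp] at hu
  rw [State.var_setVar, if_neg hne]
  exact h.var u hu

namespace Runs

variable {g : ℕ} {p : Prog} {σ : State}

/-- The rule for `Prog.forUp`: the invariant `I` need only mention what the loop changes. -/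
theorem forUp {v w : ℕ} (I : ℕ → State → Prop) (hw : (Prog.forUp v w p).modVar w = false)
    (hv : p.modVar v = false) (hg : σ.var w ≤ g) (h0 : I 0 (σ.setVar v 0))
    (step : ∀ i < σ.var w, ∀ τ, Frame (.forUp v w p) σ τ → τ.var v = i → I i τ →
      Runs env g p τ fun υ => I (i + 1) (υ.setVar v (i + 1))) :
    Runs env g (.forUp v w p) σ (I (σ.var w)) := by
  refine Runs.seq (Runs.assign ?_)
  refine (Runs.loop (fun i τ => τ.var v = i ∧ Frame (.forUp v w p) σ τ ∧ I i τ) (σ.var w) hg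
    ⟨by simp [State.var_setVar], (Frame.refl _ _).setVar, h0⟩ ?_ ?_).mono
    fun τ _ h => h.2.2
  · rintro i hi τ ⟨rfl, hF, hI⟩
    refine ⟨by simp [Expr.eval, hF.var w hw, hi], Runs.seq ?_⟩
    refine (step _ hi τ hF rfl hI).mono fun υ hF' hI' => Runs.assign ?_
    have e : (Expr.add (.var v) (.lit 1)).eval υ = τ.var v + 1 := by
      simp [Expr.eval, hF'.var v hv]
    rw [e]
    exact ⟨by simp [State.var_setVar], (hF.trans hF'.of_body).setVar, hI'⟩
  · rintro τ ⟨h, hF, -⟩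
    simp [Expr.eval, hF.var w hw, h]

/-- A loop that raises the flag `x` if `φ i` holds for some index `i`. -/
theorem forAny {v w x : ℕ} (φ : ℕ → Prop) (hw : (Prog.forUp v w p).modVar w = false)
    (hv : p.modVar v = false) (hx : x ≠ v) (hg : σ.var w ≤ g)
    (step : ∀ i < σ.var w, ∀ τ, Frame (.forUp v w p) σ τ → τ.var v = i →
      Runs env g p τ fun υ => υ.var x ≠ 0 ↔ τ.var x ≠ 0 ∨ φ i) :
    Runs env g (.forUp v w p) σ
      fun τ => τ.var x ≠ 0 ↔ σ.var x ≠ 0 ∨ ∃ i < σ.var w, φ i := by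
  refine Runs.forUp (fun t τ => τ.var x ≠ 0 ↔ σ.var x ≠ 0 ∨ ∃ i < t, φ i) hw hv hg ?_ ?_
  · simp [State.var_setVar, hx]
  · intro i hi τ hF hτ hI
    refine (step i hi τ hF hτ).mono fun υ _ hυ => ?_
    rw [State.var_setVar, if_neg hx, hυ, hI, or_assoc]
    refine or_congr_right ⟨?_, ?_⟩
    · rintro (⟨j, hj, h⟩ | h)
      exacts [⟨j, by omega, h⟩, ⟨i, by omega, h⟩]
    · rintro ⟨j, hj, h⟩
      rcases Nat.lt_succ_iff_lt_or_eq.1 hj with hj | rfl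
      exacts [Or.inl ⟨j, hj, h⟩, Or.inr h]

end Runs

end TotalCorrectness

/-! ### Finding consistent rows -/

/-- Row `j` of the term matrix `M` covers sample `p`: it has no literal that the sample falsifies.
Matrices are stored row by row: `Z (n * p + i)` is bit `i` of sample `p`, and
`M (2 * (n * j + i) + s)` says whether row `j` contains the literal `(i, s)`. -/
def RowCov (n : ℕ) (M Z : ℕ → ℕ) (j p : ℕ) : Prop :=
  ∀ i < n, M ((n * j + i) + (n * j + i) + (1 - Z (n * p + i))) = 0

theorem rowCov_iff {n : ℕ} {M Z : ℕ → ℕ} {j p : ℕ} : RowCov n M Z j p ↔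
    ∀ i : Fin n, M ((n * j + i) + (n * j + i) + (1 - Z (n * p + i))) = 0 :=
  ⟨fun h i => h i i.2, fun h i hi => h ⟨i, hi⟩⟩

/-- Some negative sample among the first `m` has bit `i` set. -/
def NegAt (n m : ℕ) (Z Y : ℕ → ℕ) (i : ℕ) : Prop :=
  ∃ p < m, Y p = 0 ∧ Z (n * p + i) ≠ 0

/-- Column `i` is set by two distinct samples among the first `m`. -/
def Shared (n m : ℕ) (Z : ℕ → ℕ) (i : ℕ) : Prop :=
  ∃ p < m, Z (n * p + i) ≠ 0 ∧ ∃ q < m, Z (n * q + i) ≠ 0 ∧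
    ∃ j < n, Z (n * p + j) ≠ Z (n * q + j)

open Classical in
/-- What is left of the code `c` after `t` cells, when each free cell consumes two bits. -/
noncomputable def rest (free : ℕ → Prop) (c : ℕ) : ℕ → ℕ
  | 0 => c
  | t + 1 => if free t then rest free c t / 2 / 2 else rest free c t

open Classical in
theorem rest_succ' (free : ℕ → Prop) (c t : ℕ) :
    rest free c (t + 1) =
      rest (fun t => free (t + 1)) (if free 0 then c / 2 / 2 else c) t := by
  induction t with
  | zero => simp [rest]
  | succ t ih => rw [rest, ih, rest]

theorem rest_le (free : ℕ → Prop) (c t : ℕ) : rest free c t ≤ c := by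
  induction t with
  | zero => exact le_rfl
  | succ t ih => rw [rest]; split <;> omega

open Classical in
/-- Every assignment of two bits to each free cell has a code. -/
theorem exists_rest (K : ℕ) (free : ℕ → Prop) (d₀ d₁ : ℕ → ℕ) (h₀ : ∀ t, d₀ t < 2)
    (h₁ : ∀ t, d₁ t < 2) : ∃ c < 4 ^ Nat.count free K, ∀ t < K, free t →
      rest free c t % 2 = d₀ t ∧ rest free c t / 2 % 2 = d₁ t := by
  induction K generalizing free d₀ d₁ with
  | zero => exact ⟨0, by simp, by simp⟩
  | succ K ih =>
    obtain ⟨c, hc, h⟩ := ih (fun t => free (t + 1)) (fun t => d₀ (t + 1)) (fun t => d₁ (t + 1))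
      (fun t => h₀ _) (fun t => h₁ _)
    have a := h₀ 0
    have b := h₁ 0
    by_cases hf : free 0
    · refine ⟨d₀ 0 + 2 * (d₁ 0 + 2 * c), ?_, ?_⟩
      · rw [Nat.count_succ', if_pos hf, pow_succ]
        omega
      · rintro (_ | t) ht hft
        · simp only [rest]
          omega
        · rw [rest_succ', if_pos hf,
            show (d₀ 0 + 2 * (d₁ 0 + 2 * c)) / 2 / 2 = c by omega]
          exact h t (by omega) hft
    · refine ⟨c, ?_, ?_⟩
      · rwa [Nat.count_succ', if_neg hf]
      · rintro (_ | t) ht hft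
        · exact absurd hft hf
        · rw [rest_succ', if_neg hf]
          exact h t (by omega) hft

open Classical in
theorem count_mod (n a : ℕ) (F : ℕ → Prop) :
    Nat.count (fun t => F (t % n)) (n * a) = a * Nat.count F n := by
  induction a with
  | zero => simp
  | succ a ih =>
    rw [Nat.mul_succ, Nat.count_add, ih, add_mul, one_mul]
    congr 1
    rw [Nat.count_eq_card_filter_range, Nat.count_eq_card_filter_range]
    congr 1
    refine Finset.filter_congr fun i hi => ?_
    rw [Nat.mul_add_mod, Nat.mod_eq_of_lt (Finset.mem_range.1 hi)]

/-- The first `T` cells (pairs of a row and a column, in the order of the matrix) of `M` are filled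
from the code `c`: on shared columns the two literals are read off the code; elsewhere a row
contains exactly the negative literals of the columns that are set by a negative sample. -/
def Filled (n m : ℕ) (Z Y : ℕ → ℕ) (c : ℕ) (M : ℕ → ℕ) (T : ℕ) : Prop :=
  ∀ t < T,
    (Shared n m Z (t % n) →
      M (t + t) = rest (fun t => Shared n m Z (t % n)) c t % 2 ∧
        M (t + t + 1) = rest (fun t => Shared n m Z (t % n)) c t / 2 % 2) ∧
    (¬ Shared n m Z (t % n) →
      (M (t + t) ≠ 0 ↔ NegAt n m Z Y (t % n)) ∧ M (t + t + 1) = 0)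

theorem Filled.congr {n m : ℕ} {Z Y : ℕ → ℕ} {c : ℕ} {M M' : ℕ → ℕ} {T : ℕ}
    (h : Filled n m Z Y c M T) (e : ∀ q < T + T, M' q = M q) : Filled n m Z Y c M' T := by
  intro t ht
  rw [e _ (by omega), e _ (by omega)]
  exact h t ht

theorem Filled.succ {n m : ℕ} {Z Y : ℕ → ℕ} {c : ℕ} {M : ℕ → ℕ} {T : ℕ}
    (h : Filled n m Z Y c M T)
    (hs : Shared n m Z (T % n) →
      M (T + T) = rest (fun t => Shared n m Z (t % n)) c T % 2 ∧
        M (T + T + 1) = rest (fun t => Shared n m Z (t % n)) c T / 2 % 2)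
    (hu : ¬ Shared n m Z (T % n) →
      (M (T + T) ≠ 0 ↔ NegAt n m Z Y (T % n)) ∧ M (T + T + 1) = 0) :
    Filled n m Z Y c M (T + 1) := by
  intro t ht
  rcases Nat.lt_succ_iff_lt_or_eq.1 ht with ht | rfl
  exacts [h t ht, ⟨hs, hu⟩]

theorem cell_lt {n i j a : ℕ} (hi : i < n) (hj : j < a) : n * j + i < n * a := by
  have := Nat.mul_le_mul_left n (Nat.succ_le_of_lt hj)
  rw [Nat.mul_succ] at this
  omega

/-- Bits of sample `p`. -/
def sampleRow (n : ℕ) (Z : ℕ → ℕ) (p : ℕ) : Fin n → ℕ := fun i => Z (n * p + i)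

open Classical in
/-- The sample vectors among the first `t` samples that are positive but not covered by the first
`a` rows. -/
noncomputable def uncovered (n : ℕ) (Z Y M : ℕ → ℕ) (a t : ℕ) : Finset (Fin n → ℕ) :=
  ((Finset.range t).filter fun p => Y p ≠ 0 ∧ ∀ j < a, ¬ RowCov n M Z j p).image (sampleRow n Z)

/-- The first `a` rows of `M` cover no negative sample, and so few positive samples are left that
each of them can be given a row of its own. -/
def Lucky (n m k : ℕ) (Z Y M : ℕ → ℕ) (a : ℕ) : Prop :=
  (∀ p < m, Y p = 0 → ∀ j < a, ¬ RowCov n M Z j p) ∧ a + (uncovered n Z Y M a m).card ≤ k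

/-- The first `f` rows of `M` are consistent with all samples. -/
def Consistent (n m : ℕ) (Z Y M : ℕ → ℕ) (f : ℕ) : Prop :=
  ∀ p < m, Y p ≠ 0 ↔ ∃ j < f, RowCov n M Z j p

theorem Consistent.congr_label {n m : ℕ} {Z Y N : ℕ → ℕ} {k p q : ℕ}
    (h : Consistent n m Z Y N k) (hp : p < m) (hq : q < m)
    (e : ∀ i < n, Z (n * p + i) = Z (n * q + i)) : Y p ≠ 0 ↔ Y q ≠ 0 := by
  rw [h p hp, h q hq]
  refine exists_congr fun j => and_congr_right fun _ => forall₂_congr fun i hi => ?_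
  rw [e i hi]

open Classical in
/-- The heart of the algorithm: if some `k` rows are consistent with the samples, then so is a
matrix that arises from some code. Rows without positive literals outside of the shared columns
come from a code (adding negative literals is harmless there, because the column of a negative
sample belongs to no positive one); each of the other rows covers at most one sample vector. -/
theorem exists_lucky {n m k l : ℕ} {Z Y N : ℕ → ℕ} (hZ : ∀ q, Z q < 2)
    (hN : Consistent n m Z Y N k) (hl : Nat.count (Shared n m Z) n ≤ l) :
    ∃ a ≤ k, ∃ c < 4 ^ (k * l), ∀ M, Filled n m Z Y c M (n * a) → Lucky n m k Z Y M a := by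
  let A := (Finset.range k).filter fun j => ∀ i < n, ¬ Shared n m Z i →
    N ((n * j + i) + (n * j + i) + 1) = 0
  have hAk : A.card ≤ k := (Finset.card_filter_le _ _).trans (by simp)
  let e : Fin A.card → ℕ := fun j => A.equivFin.symm j
  have he (j) : e j ∈ A := (A.equivFin.symm j).2
  let d (s : ℕ) (t : ℕ) : ℕ :=
    if h : t / n < A.card then
      if N ((n * e ⟨t / n, h⟩ + t % n) + (n * e ⟨t / n, h⟩ + t % n) + s) = 0 then 0 else 1
    else 0
  have hd (s t) : d s t < 2 := by
    simp only [d]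
    split_ifs <;> omega
  obtain ⟨c, hc, hcd⟩ := exists_rest (n * A.card) (fun t => Shared n m Z (t % n)) (d 0) (d 1)
    (hd 0) (hd 1)
  refine ⟨A.card, hAk, c, hc.trans_le ?_, fun M hM => ?_⟩
  · rw [count_mod]
    exact Nat.pow_le_pow_right (by norm_num) (Nat.mul_le_mul hAk hl)
  -- A column outside of the shared ones determines the sample.
  have huniq {i p q} (hi : ¬ Shared n m Z i) (hp : p < m) (hq : q < m)
      (h : Z (n * p + i) ≠ 0) (h' : Z (n * q + i) ≠ 0) :
      ∀ j < n, Z (n * p + j) = Z (n * q + j) := by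
    by_contra! hne
    exact hi ⟨p, hp, h, q, hq, h', hne⟩
  have hM (j) (hj : j < A.card) (i) (hi : i < n) := hM (n * j + i) (cell_lt hi hj)
  have hmod (j) {i} (hi : i < n) : (n * j + i) % n = i := by
    rw [Nat.mul_add_mod, Nat.mod_eq_of_lt hi]
  have hbit {x : ℕ} (hx : x < 2) : x = 0 ∨ x = 1 := by omega
  -- On shared columns, the filled rows agree with the rows of `N` that they stand for.
  have hshared (j : Fin A.card) (i) (hi : i < n) (hs : Shared n m Z i) (s) (h2 : s < 2) :
      M ((n * j + i) + (n * j + i) + s) = 0 ↔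
        N ((n * e j + i) + (n * e j + i) + s) = 0 := by
    have hdiv : (n * j + i) / n = j := by
      rw [Nat.mul_add_div (by omega), Nat.div_eq_of_lt hi, add_zero]
    have hlt : n * j + i < n * A.card := cell_lt hi j.2
    have hval : d s (n * j + i) = 0 ↔ N ((n * e j + i) + (n * e j + i) + s) = 0 := by
      simp only [d, hdiv, hmod _ hi, j.2, dif_pos, Fin.eta]
      split_ifs with h <;> simp [h]
    have hF := (hM j j.2 i hi).1 (by rwa [hmod _ hi])
    have hC := hcd _ hlt (by simpa only [hmod _ hi] using hs)
    rcases hbit h2 with rfl | rfl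
    · rw [← hval, ← hC.1, ← hF.1, add_zero]
    · rw [← hval, ← hC.2, ← hF.2]
  have hneg {j p} (hj : j ∈ A) (hp : p < m) (hy : Y p = 0) : ¬ RowCov n N Z j p := fun h =>
    (hN p hp).2 ⟨j, Finset.mem_range.1 (Finset.mem_filter.1 hj).1, h⟩ hy
  refine ⟨fun p hp hy j hj hcov => ?_, ?_⟩
  · refine hneg (he ⟨j, hj⟩) hp hy fun i hi => ?_
    by_cases hs : Shared n m Z i
    · exact (hshared ⟨j, hj⟩ i hi hs _ (by omega)).1 (hcov i hi)
    · have hF := (hM j hj i hi).2 (by rwa [hmod _ hi])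
      rw [hmod _ hi] at hF
      have hA := (Finset.mem_filter.1 (he ⟨j, hj⟩)).2 i hi hs
      have hci := hcov i hi
      rcases hbit (hZ (n * p + i)) with hz | hz
      · rwa [hz]
      · rw [hz] at hci
        exact absurd hci (hF.1.2 ⟨p, hp, hy, by omega⟩)
  · -- A positive sample that a row in `A` covers stays covered.
    have hpos {p} (hp : p < m) (hy : Y p ≠ 0) (hu : ∀ j < A.card, ¬ RowCov n M Z j p) :
        ∃ j ∈ Finset.range k \ A, RowCov n N Z j p := by
      obtain ⟨j, hj, hcov⟩ := (hN p hp).1 hy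
      refine ⟨j, Finset.mem_sdiff.2 ⟨Finset.mem_range.2 hj, fun hjA => ?_⟩, hcov⟩
      obtain ⟨j', hj'⟩ : ∃ j', e j' = j := ⟨A.equivFin ⟨j, hjA⟩, by simp [e]⟩
      subst hj'
      refine hu j' j'.2 fun i hi => ?_
      by_cases hs : Shared n m Z i
      · exact (hshared j' i hi hs _ (by omega)).2 (hcov i hi)
      · have hF := (hM j' j'.2 i hi).2 (by rwa [hmod _ hi])
        rw [hmod _ hi] at hF
        rcases hbit (hZ (n * p + i)) with hz | hz
        · rw [hz]
          exact hF.2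
        · rw [hz]
          by_contra hne
          obtain ⟨q, hq, hyq, hzq⟩ := hF.1.1 hne
          exact (hN.congr_label hp hq (huniq hs hp hq (by omega) hzq)).1 hy hyq
    have hcard : (uncovered n Z Y M A.card m).card ≤ (Finset.range k \ A).card := by
      have hex : ∀ v ∈ uncovered n Z Y M A.card m, ∃ j ∈ Finset.range k \ A, ∃ p < m,
          sampleRow n Z p = v ∧ RowCov n N Z j p := by
        intro v hv
        obtain ⟨p, hp, rfl⟩ := Finset.mem_image.1 hv
        obtain ⟨hp, hy, hu⟩ := Finset.mem_filter.1 hp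
        obtain ⟨j, hj, hcov⟩ := hpos (Finset.mem_range.1 hp) hy hu
        exact ⟨j, hj, p, Finset.mem_range.1 hp, rfl, hcov⟩
      choose! r hr hr' using hex
      refine Finset.card_le_card_of_injOn r hr fun v hv v' hv' hvv => ?_
      obtain ⟨p, hp, hpv, hcov⟩ := hr' v hv
      obtain ⟨q, hq, hqv, hcov'⟩ := hr' v' hv'
      -- The row has a positive literal outside of the shared columns.
      obtain ⟨i, hi, hs, hne⟩ : ∃ i < n, ¬ Shared n m Z i ∧
          N ((n * r v + i) + (n * r v + i) + 1) ≠ 0 := by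
        have h := Finset.mem_sdiff.1 (hr v hv)
        by_contra! h'
        exact h.2 (Finset.mem_filter.2 ⟨h.1, h'⟩)
      rw [← hvv] at hcov'
      have hz {p} (h : RowCov n N Z (r v) p) : Z (n * p + i) ≠ 0 := by
        intro h0
        have := h i hi
        rw [h0] at this
        exact hne this
      rw [← hpv, ← hqv]
      funext j
      exact huniq hs hp hq (hz hcov) (hz hcov') j j.2
    rw [Finset.card_sdiff_of_subset (Finset.filter_subset _ _), Finset.card_range] at hcard
    change (uncovered n Z Y M A.card m).card ≤ k - A.card at hcard
    omega

theorem RowCov.congr {n : ℕ} {M M' Z : ℕ → ℕ} {j p f : ℕ} (hj : j < f)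
    (h : ∀ q < n * f + n * f, M' q = M q) : RowCov n M' Z j p ↔ RowCov n M Z j p := by
  refine forall₂_congr fun i hi => ?_
  have := cell_lt hi hj
  rw [h _ (by omega)]

/-- The state of the greedy completion of `M₀` after `t` samples: from row `a` to row `f - 1`, the
rows of `M` are the full descriptions of positive samples that the previous rows do not cover. -/
structure Greedy (n : ℕ) (Z Y M₀ : ℕ → ℕ) (a t f : ℕ) (M : ℕ → ℕ) : Prop where
  ge : a ≤ f
  old : ∀ q < n * a + n * a, M q = M₀ q
  card : f ≤ a + (uncovered n Z Y M₀ a t).card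
  row : ∀ j, a ≤ j → j < f →
    ∃ q < t, Y q ≠ 0 ∧ ∀ p, RowCov n M Z j p → sampleRow n Z p = sampleRow n Z q
  cov : ∀ p < t, Y p ≠ 0 → ∃ j < f, RowCov n M Z j p

open Classical in
theorem uncovered_succ (n : ℕ) (Z Y M : ℕ → ℕ) (a t : ℕ) :
    uncovered n Z Y M a (t + 1) =
      if Y t ≠ 0 ∧ ∀ j < a, ¬ RowCov n M Z j t then
        insert (sampleRow n Z t) (uncovered n Z Y M a t)
      else uncovered n Z Y M a t := by
  unfold uncovered
  rw [Finset.range_add_one, Finset.filter_insert]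
  split_ifs
  · rw [Finset.image_insert]
  · rfl

theorem uncovered_subset (n : ℕ) (Z Y M : ℕ → ℕ) (a : ℕ) {t t' : ℕ} (h : t ≤ t') :
    uncovered n Z Y M a t ⊆ uncovered n Z Y M a t' := by
  classical
  exact Finset.image_subset_image (Finset.filter_subset_filter _ (Finset.range_subset_range.2 h))

theorem RowCov.congr_sample {n : ℕ} {M Z : ℕ → ℕ} {j p q : ℕ}
    (h : sampleRow n Z p = sampleRow n Z q) : RowCov n M Z j p ↔ RowCov n M Z j q := by
  refine forall₂_congr fun i hi => ?_
  rw [show Z (n * p + i) = Z (n * q + i) from congrFun h ⟨i, hi⟩]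

namespace Greedy

variable {n m k : ℕ} {Z Y M₀ M : ℕ → ℕ} {a t f : ℕ}

theorem init : Greedy n Z Y M₀ a 0 a M₀ :=
  ⟨le_rfl, fun _ _ => rfl, by omega, fun _ _ _ => by omega, fun _ _ => by omega⟩

theorem congr {M' : ℕ → ℕ} (h : Greedy n Z Y M₀ a t f M)
    (e : ∀ q < n * f + n * f, M' q = M q) : Greedy n Z Y M₀ a t f M' where
  ge := h.ge
  old q hq := by
    have := Nat.mul_le_mul_left n h.ge
    rw [e q (by omega), h.old q hq]
  card := h.card
  row j hj hjf := by
    obtain ⟨q, hq, hy, hr⟩ := h.row j hj hjf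
    exact ⟨q, hq, hy, fun p hp => hr p ((RowCov.congr hjf e).1 hp)⟩
  cov p hp hy := by
    obtain ⟨j, hj, hc⟩ := h.cov p hp hy
    exact ⟨j, hj, (RowCov.congr hj e).2 hc⟩

theorem notMem (h : Greedy n Z Y M₀ a t f M)
    (hu : ∀ j < f, ¬ RowCov n M Z j t) : sampleRow n Z t ∉ uncovered n Z Y M₀ a t := by
  classical
  intro hmem
  obtain ⟨p, hp, e⟩ := Finset.mem_image.1 hmem
  obtain ⟨hp, hy, -⟩ := Finset.mem_filter.1 hp
  obtain ⟨j, hj, hc⟩ := h.cov p (Finset.mem_range.1 hp) hy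
  exact hu j hj ((RowCov.congr_sample e).1 hc)

theorem card_succ (h : Greedy n Z Y M₀ a t f M)
    (hy : Y t ≠ 0) (hu : ∀ j < f, ¬ RowCov n M Z j t) :
    (uncovered n Z Y M₀ a (t + 1)).card = (uncovered n Z Y M₀ a t).card + 1 := by
  classical
  rw [uncovered_succ, if_pos, Finset.card_insert_of_notMem (h.notMem hu)]
  exact ⟨hy, fun j hj hc => hu j (hj.trans_le h.ge) ((RowCov.congr hj h.old).2 hc)⟩

/-- A sample that needs no new row, or for which there is no room. -/
theorem keep (h : Greedy n Z Y M₀ a t f M) (hL : Lucky n m k Z Y M₀ a) (ht : t < m)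
    (hk : Y t ≠ 0 → (∀ j < f, ¬ RowCov n M Z j t) → k ≤ f) :
    Greedy n Z Y M₀ a (t + 1) f M where
  ge := h.ge
  old := h.old
  card := h.card.trans
    (Nat.add_le_add_left (Finset.card_le_card (uncovered_subset _ _ _ _ _ t.le_succ)) _)
  row j hj hjf := by
    obtain ⟨q, hq, hr⟩ := h.row j hj hjf
    exact ⟨q, hq.trans t.lt_succ_self, hr⟩
  cov p hp hy := by
    rcases Nat.lt_succ_iff_lt_or_eq.1 hp with hp | rfl
    · exact h.cov p hp hy
    · by_contra! hu
      have h1 := h.card_succ hy hu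
      have h2 := Finset.card_le_card (uncovered_subset n Z Y M₀ a (Nat.succ_le_of_lt ht))
      have := hL.2
      have := hk hy hu
      have := h.card
      rw [Nat.succ_eq_add_one] at h2
      omega

/-- A sample that gets a new row. -/
theorem add (h : Greedy n Z Y M₀ a t f M)
    (hZ : ∀ q, Z q < 2) (hy : Y t ≠ 0) (hu : ∀ j < f, ¬ RowCov n M Z j t)
    {M' : ℕ → ℕ} (e : ∀ q < n * f + n * f, M' q = M q)
    (hrow : ∀ i < n, M' ((n * f + i) + (n * f + i)) = 1 - Z (n * t + i) ∧
      M' ((n * f + i) + (n * f + i) + 1) = Z (n * t + i)) :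
    Greedy n Z Y M₀ a (t + 1) (f + 1) M' := by
  have h' := h.congr e
  have hbit (x : ℕ) (hx : x < 2) : x = 0 ∨ x = 1 := by omega
  have hf (p : ℕ) : RowCov n M' Z f p ↔ sampleRow n Z p = sampleRow n Z t := by
    refine Iff.trans ?_ (funext_iff (f := sampleRow n Z p) (g := sampleRow n Z t)).symm
    refine ⟨fun hc i => ?_, fun hp i hi => ?_⟩
    · have := hc i i.2
      have hr := hrow i i.2
      rw [show sampleRow n Z p i = Z (n * p + i) from rfl,
        show sampleRow n Z t i = Z (n * t + i) from rfl]
      rcases hbit _ (hZ (n * p + i)) with hz | hz <;>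
        rcases hbit _ (hZ (n * t + i)) with hz' | hz' <;>
        simp only [hz, hz'] at this hr ⊢ <;> simp_all
    · have := hp ⟨i, hi⟩
      have hr := hrow i hi
      rw [show sampleRow n Z p ⟨i, hi⟩ = Z (n * p + i) from rfl,
        show sampleRow n Z t ⟨i, hi⟩ = Z (n * t + i) from rfl] at this
      rcases hbit _ (hZ (n * t + i)) with hz' | hz' <;>
        simp only [this, hz'] at hr ⊢ <;> simp_all
  refine ⟨h'.ge.trans f.le_succ, h'.old, ?_, fun j hj hjf => ?_, fun p hp hyp => ?_⟩
  · rw [h.card_succ hy hu]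
    have := h.card
    omega
  · rcases Nat.lt_succ_iff_lt_or_eq.1 hjf with hjf | rfl
    · obtain ⟨q, hq, hr⟩ := h'.row j hj hjf
      exact ⟨q, hq.trans t.lt_succ_self, hr⟩
    · exact ⟨t, t.lt_succ_self, hy, fun p => (hf p).1⟩
  · rcases Nat.lt_succ_iff_lt_or_eq.1 hp with hp | rfl
    · obtain ⟨j, hj, hc⟩ := h'.cov p hp hyp
      exact ⟨j, hj.trans f.lt_succ_self, hc⟩
    · exact ⟨f, f.lt_succ_self, (hf p).2 rfl⟩

theorem consistent (h : Greedy n Z Y M₀ a m f M) (hL : Lucky n m k Z Y M₀ a)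
    {N : ℕ → ℕ} (hN : Consistent n m Z Y N k) : Consistent n m Z Y M f := by
  intro p hp
  refine ⟨h.cov p hp, ?_⟩
  rintro ⟨j, hj, hc⟩
  by_cases hja : j < a
  · exact fun hy => hL.1 p hp hy j hja ((RowCov.congr hja h.old).1 hc)
  · obtain ⟨q, hq, hy, hr⟩ := h.row j (by omega) hj
    exact (hN.congr_label hp hq fun i hi => congrFun (hr p hc) ⟨i, hi⟩).2 hy

end Greedy

/-! ### The program: preprocessing and evaluation of rows -/

/-! The variables of the program. The inputs `n`, `k`, `ℓ`, and the numerators and denominators of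
`ε` and `δ` are in the variables `0` to `6`. Then `vEps` and `vDelta` hold `⌈1 / ε⌉` and
`⌈1 / δ⌉`, `vM` the number `m` of samples, `vMK` the sum `m + k`, `vCodes` the number of codes and
`vF` the number of rows in use; `vP`, `vQ` count samples, `vI` columns, `vJ` rows, `vA` the rows
that are filled from the code `vC`, whose unread part is `vRest`. The constants `vPos`, `vLab` and
`vSwap` select one of the four learning problems. -/

section Program

local notation "vN" => (0 : ℕ)
local notation "vK" => (1 : ℕ)
local notation "vL" => (2 : ℕ)
local notation "vEps" => (7 : ℕ)
local notation "vDelta" => (8 : ℕ)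
local notation "vAcc" => (9 : ℕ)
local notation "vM" => (10 : ℕ)
local notation "vMK" => (11 : ℕ)
local notation "vP" => (12 : ℕ)
local notation "vI" => (13 : ℕ)
local notation "vY" => (14 : ℕ)
local notation "vQ" => (15 : ℕ)
local notation "vJ" => (16 : ℕ)
local notation "vFlag" => (17 : ℕ)
local notation "vCodes" => (18 : ℕ)
local notation "vA" => (19 : ℕ)
local notation "vC" => (20 : ℕ)
local notation "vDone" => (21 : ℕ)
local notation "vF" => (22 : ℕ)
local notation "vRest" => (23 : ℕ)
local notation "vBad" => (24 : ℕ)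
local notation "vCov" => (25 : ℕ)
local notation "vK1" => (26 : ℕ)
local notation "vPos" => (27 : ℕ)
local notation "vLab" => (28 : ℕ)
local notation "vSwap" => (29 : ℕ)

/-! The arrays of the program: the sample that was drawn last, the normalized samples and labels,
the multiples of `n` (the machine does not multiply), the flags of the shared columns, the matrix of
rows, the flags of the columns set by a negative sample, and a table of halves. -/

local notation "aRaw" => (0 : ℕ)
local notation "aZ" => (1 : ℕ)
local notation "aY" => (2 : ℕ)
local notation "aMul" => (3 : ℕ)
local notation "aShared" => (4 : ℕ)
local notation "aM" => (5 : ℕ)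
local notation "aNeg" => (6 : ℕ)
local notation "aHalf" => (7 : ℕ)

open ParamPAC.Expr ParamPAC.Prog

attribute [local simp] Expr.eval

/-- The number of the cell in row `u`, column `v`. -/
def cellE (u v : ℕ) : Expr := add (get aMul (var u)) (var v)

/-- Bit `v` of sample `u`. -/
def sampleE (u v : ℕ) : Expr := get aZ (cellE u v)

/-- The position of the literal of sign `s` in the cell in row `u`, column `v`. -/
def litE (u v : ℕ) (s : Expr) : Expr := add (add (cellE u v) (cellE u v)) s

attribute [local simp] cellE sampleE litE

/-- What the phases after sampling need to know about the memory. -/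
structure Setup (n m k : ℕ) (σ : State) : Prop where
  var_n : σ.var vN = n
  var_k : σ.var vK = k
  var_m : σ.var vM = m
  mul : ∀ j < m + k, σ.mem aMul j = n * j
  bit : ∀ q, σ.mem aZ q < 2

theorem Setup.frame {n m k : ℕ} {σ τ : State} {p : Prog} (h : Setup n m k σ) (hF : Frame p σ τ)
    (hn : p.modVar vN = false) (hk : p.modVar vK = false) (hm : p.modVar vM = false)
    (hmul : p.modMem aMul = false) (hZ : p.modMem aZ = false) : Setup n m k τ := by
  refine ⟨?_, ?_, ?_, ?_, ?_⟩
  · rw [hF.var _ hn, h.var_n]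
  · rw [hF.var _ hk, h.var_k]
  · rw [hF.var _ hm, h.var_m]
  · rw [hF.mem _ hmul]
    exact h.mul
  · rw [hF.mem _ hZ]
    exact h.bit

theorem Setup.setVar {n m k : ℕ} {σ : State} (h : Setup n m k σ) {v c : ℕ} (hn : vN ≠ v)
    (hk : vK ≠ v) (hm : vM ≠ v) : Setup n m k (σ.setVar v c) :=
  ⟨by simp [hn, h.var_n], by simp [hk, h.var_k], by simp [hm, h.var_m], h.mul, h.bit⟩

/-- Sets the flag `vCov` if some row covers sample `vP`. -/
def covers : Prog :=
  seq (assign vCov (lit 0)) <| forUp vJ vF <|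
    seq (assign vBad (lit 0)) <|
    seq (forUp vI vN <|
      ite (get aM (litE vJ vI (sub (lit 1) (sampleE vP vI)))) (assign vBad (lit 1)) skip) <|
    ite (var vBad) skip (assign vCov (lit 1))

variable {n m k : ℕ} {env : Env n} {g : ℕ} {σ : State}

theorem runs_covers (hS : Setup n m k σ) (hp : σ.var vP < m) (hf : σ.var vF ≤ k) (gn : n ≤ g)
    (gk : k ≤ g) :
    Runs env g covers σ fun τ => τ.var vCov ≠ 0 ↔
      ∃ j < σ.var vF, RowCov n (σ.mem aM) (σ.mem aZ) j (σ.var vP) := by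
  have hp := hS.mul _ (hp.trans_le (Nat.le_add_right _ _))
  refine Runs.seq (Runs.assign ?_)
  refine Runs.mono (Runs.forAny (x := vCov) (fun j => RowCov n (σ.mem aM) (σ.mem aZ) j (σ.var vP))
    rfl rfl (by decide) (hf.trans gk) fun j hj τ hF hτ => ?_) fun τ _ h => ?_
  · refine Runs.seq (Runs.assign (Runs.seq ?_))
    have hj' : j < m + k := lt_of_lt_of_le hj (hf.trans (Nat.le_add_left _ _))
    refine Runs.mono (Runs.forAny (x := vBad) (fun i => σ.mem aM ((n * j + i) + (n * j + i) +
      (1 - σ.mem aZ (n * σ.var vP + i))) ≠ 0) rfl rfl (by decide) ?_ ?_) ?_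
    · simpa (disch := decide) [hF.var, hS.var_n] using gn
    · intro i _ υ hF' hυ
      have e : (get aM (litE vJ vI (sub (lit 1) (sampleE vP vI)))).eval υ =
          σ.mem aM ((n * j + i) + (n * j + i) + (1 - σ.mem aZ (n * σ.var vP + i))) := by
        simp (disch := decide) [hF'.var, hF'.mem, hF.var, hF.mem, hυ, hτ, hp, hS.mul j hj']
      refine Runs.ite (fun h => Runs.assign ?_) (fun h => Runs.skip ?_)
      · rw [e] at h
        simp [h]
      · rw [e] at h
        simp [h]
    · intro υ hF' h
      simp (disch := decide) only [State.var_setVar, hF.var, hS.var_n, Expr.eval] at h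
      refine Runs.ite (fun hb => Runs.skip ?_) (fun hb => Runs.assign ?_)
      · obtain ⟨i, hi, hne⟩ := (h.1 hb).resolve_left (by simp)
        have : ¬ RowCov n (σ.mem aM) (σ.mem aZ) j (σ.var vP) := fun hc =>
          hne (hc i (by simpa using hi))
        simp (disch := decide) [hF'.var, this]
      · have : RowCov n (σ.mem aM) (σ.mem aZ) j (σ.var vP) := by
          intro i hi
          by_contra hne
          exact h.2 (Or.inr ⟨i, by simpa using hi, hne⟩) hb
        simp [this]
  · simpa using h

/-- Computes for each column whether it is set by two distinct samples. -/
def findShared : Prog :=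
  forUp vI vN <| seq (assign vFlag (lit 0)) <|
    seq (forUp vP vM <| ite (sampleE vP vI)
      (forUp vQ vM <| ite (sampleE vQ vI)
        (forUp vJ vN <| ite (eq (sampleE vP vJ) (sampleE vQ vJ)) skip (assign vFlag (lit 1)))
        skip)
      skip) <|
    store aShared (var vI) (var vFlag)

theorem runs_findShared (hS : Setup n m k σ) (gn : n ≤ g) (gm : m ≤ g) :
    Runs env g findShared σ fun τ =>
      ∀ i < n, τ.mem aShared i ≠ 0 ↔ Shared n m (σ.mem aZ) i := by
  refine Runs.mono (Runs.forUp (fun t τ => ∀ i < t, τ.mem aShared i ≠ 0 ↔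
    Shared n m (σ.mem aZ) i) rfl rfl (by rwa [hS.var_n]) (by simp) ?_)
    fun τ _ h => by rwa [hS.var_n] at h
  intro i hi τ hF hτ hI
  refine Runs.seq (Runs.assign (Runs.seq ?_))
  refine Runs.mono (Runs.forAny (x := vFlag) (fun p => σ.mem aZ (n * p + i) ≠ 0 ∧
    ∃ q < m, σ.mem aZ (n * q + i) ≠ 0 ∧ ∃ j < n, σ.mem aZ (n * p + j) ≠ σ.mem aZ (n * q + j))
    rfl rfl (by decide) ?_ ?_) ?_
  · simpa (disch := decide) [hF.var, hS.var_m] using gm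
  · intro p hp υ hF' hυ
    have hp : p < m := by simpa (disch := decide) [hF.var, hS.var_m] using hp
    have hp' := hS.mul p (by omega)
    refine Runs.ite (fun h => ?_) (fun h => Runs.skip ?_)
    · have h : σ.mem aZ (n * p + i) ≠ 0 := by
        simpa (disch := decide) [hF'.var, hF'.mem, hF.var, hF.mem, hυ, hτ, hp'] using h
      refine Runs.mono (Runs.forAny (x := vFlag) (fun q => σ.mem aZ (n * q + i) ≠ 0 ∧
        ∃ j < n, σ.mem aZ (n * p + j) ≠ σ.mem aZ (n * q + j)) rfl rfl (by decide) ?_ ?_) ?_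
      · simpa (disch := decide) [hF'.var, hF.var, hS.var_m] using gm
      · intro q hq υ' hF'' hυ'
        have hq : q < m := by simpa (disch := decide) [hF'.var, hF.var, hS.var_m] using hq
        have hq' := hS.mul q (by omega)
        refine Runs.ite (fun h => ?_) (fun h => Runs.skip ?_)
        · have h : σ.mem aZ (n * q + i) ≠ 0 := by
            simpa (disch := decide) [hF''.var, hF''.mem, hF'.var, hF'.mem, hF.var, hF.mem, hυ, hτ,
              hυ', hq'] using h
          refine Runs.mono (Runs.forAny (x := vFlag) (fun j =>
            σ.mem aZ (n * p + j) ≠ σ.mem aZ (n * q + j)) rfl rfl (by decide) ?_ ?_) ?_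
          · simpa (disch := decide) [hF''.var, hF'.var, hF.var, hS.var_n] using gn
          · intro j hj ρ hG hρ
            have e : (eq (sampleE vP vJ) (sampleE vQ vJ)).eval ρ =
                if σ.mem aZ (n * p + j) = σ.mem aZ (n * q + j) then 1 else 0 := by
              simp (disch := decide) [hG.var, hG.mem, hF''.var, hF''.mem, hF'.mem, hF.mem,
                hυ, hυ', hρ, hp', hq']
            refine Runs.ite (fun h => Runs.skip ?_) (fun h => Runs.assign ?_)
            · rw [e] at h
              simp_all
            · rw [e] at h
              simp_all
          · intro ρ _ hρ
            rw [hρ]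
            simp (disch := decide) [hF''.var, hF'.var, hF.var, hS.var_n, h]
        · have h : σ.mem aZ (n * q + i) = 0 := by
            simpa (disch := decide) [hF''.var, hF''.mem, hF'.var, hF'.mem, hF.var, hF.mem, hυ, hτ,
              hυ', hq'] using h
          simp [h]
      · intro ρ _ hρ
        rw [hρ]
        simp (disch := decide) [hF'.var, hF.var, hS.var_m, h]
    · have h : σ.mem aZ (n * p + i) = 0 := by
        simpa (disch := decide) [hF'.var, hF'.mem, hF.var, hF.mem, hυ, hτ, hp'] using h
      simp [h]
  · intro υ hF' h
    have h : υ.var vFlag ≠ 0 ↔ Shared n m (σ.mem aZ) i := by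
      rw [h]
      simp (disch := decide) [hF.var, hS.var_m, Shared]
    refine Runs.store fun i' hi' => ?_
    have e : υ.var vI = i := by simp (disch := decide) [hF'.var, hτ]
    rcases Nat.lt_succ_iff_lt_or_eq.1 hi' with hi' | rfl
    · have := hI i' hi'
      simpa (disch := decide) [e, Function.update_apply, hi'.ne, hF'.mem] using this
    · simpa [e] using h

/-- Computes for each column whether it is set by a negative sample. -/
def findNeg : Prog :=
  forUp vI vN <| seq (assign vFlag (lit 0)) <|
    seq (forUp vP vM <| ite (sampleE vP vI)
      (ite (get aY (var vP)) skip (assign vFlag (lit 1))) skip) <|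
    store aNeg (var vI) (var vFlag)

theorem runs_findNeg (hS : Setup n m k σ) (gn : n ≤ g) (gm : m ≤ g) :
    Runs env g findNeg σ fun τ =>
      ∀ i < n, τ.mem aNeg i ≠ 0 ↔ NegAt n m (σ.mem aZ) (σ.mem aY) i := by
  refine Runs.mono (Runs.forUp (fun t τ => ∀ i < t, τ.mem aNeg i ≠ 0 ↔
    NegAt n m (σ.mem aZ) (σ.mem aY) i) rfl rfl (by rwa [hS.var_n]) (by simp) ?_)
    fun τ _ h => by rwa [hS.var_n] at h
  intro i hi τ hF hτ hI
  refine Runs.seq (Runs.assign (Runs.seq ?_))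
  refine Runs.mono (Runs.forAny (x := vFlag) (fun p => σ.mem aY p = 0 ∧ σ.mem aZ (n * p + i) ≠ 0)
    rfl rfl (by decide) ?_ ?_) ?_
  · simpa (disch := decide) [hF.var, hS.var_m] using gm
  · intro p hp υ hF' hυ
    have hp : p < m := by simpa (disch := decide) [hF.var, hS.var_m] using hp
    have hp' := hS.mul p (by omega)
    have e : (sampleE vP vI).eval υ = σ.mem aZ (n * p + i) := by
      simp (disch := decide) [hF'.var, hF'.mem, hF.mem, hυ, hτ, hp']
    have e' : (get aY (var vP)).eval υ = σ.mem aY p := by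
      simp (disch := decide) [hF'.mem, hF.mem, hυ]
    refine Runs.ite (fun h => Runs.ite (fun h' => Runs.skip ?_) (fun h' => Runs.assign ?_))
      (fun h => Runs.skip ?_)
    · rw [e'] at h'
      simp [h']
    · rw [e'] at h'
      rw [e] at h
      simp [h', h]
    · rw [e] at h
      simp [h]
  · intro υ hF' h
    have h : υ.var vFlag ≠ 0 ↔ NegAt n m (σ.mem aZ) (σ.mem aY) i := by
      rw [h]
      simp (disch := decide) [hF.var, hS.var_m, NegAt]
    refine Runs.store fun i' hi' => ?_
    have e : υ.var vI = i := by simp (disch := decide) [hF'.var, hτ]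
    rcases Nat.lt_succ_iff_lt_or_eq.1 hi' with hi' | rfl
    · have := hI i' hi'
      simpa (disch := decide) [e, Function.update_apply, hi'.ne, hF'.mem] using this
    · simpa [e] using h

/-! ### The program: search -/

/-- Computes the number `4 ^ (k * ℓ)` of codes. -/
def countCodes : Prog :=
  seq (assign vCodes (lit 1)) <| forUp vI vK <| forUp vJ vL <|
    seq (assign vCodes (add (var vCodes) (var vCodes)))
      (assign vCodes (add (var vCodes) (var vCodes)))

theorem runs_countCodes (gk : σ.var vK ≤ g) (gl : σ.var vL ≤ g) :
    Runs env g countCodes σ fun τ => τ.var vCodes = 4 ^ (σ.var vK * σ.var vL) := by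
  refine Runs.seq (Runs.assign ?_)
  refine Runs.forUp (fun t τ => τ.var vCodes = 4 ^ (t * σ.var vL)) rfl rfl gk (by simp) ?_
  intro i _ τ hF _ hI
  have e : τ.var vL = σ.var vL := by simp (disch := decide) [hF.var]
  refine Runs.mono (Runs.forUp (fun t τ => τ.var vCodes = 4 ^ (i * σ.var vL + t)) rfl rfl
    (by rwa [e]) (by simpa using hI) ?_) fun υ _ h => ?_
  · intro j _ υ _ _ hJ
    refine Runs.seq (Runs.assign (Runs.assign ?_))
    simp [hJ, ← add_assoc, pow_succ]
    ring
  · simp [h, e, add_mul]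

/-- Tabulates `q / 2` for all `q` below twice the number of codes. -/
def tabulateHalves : Prog :=
  forUp vQ vCodes <| seq (store aHalf (add (var vQ) (var vQ)) (var vQ))
    (store aHalf (add (add (var vQ) (var vQ)) (lit 1)) (var vQ))

theorem runs_tabulateHalves (gc : σ.var vCodes ≤ g) :
    Runs env g tabulateHalves σ fun τ => ∀ q < σ.var vCodes, τ.mem aHalf q = q / 2 := by
  refine Runs.mono (Runs.forUp (fun t τ => ∀ q < t + t, τ.mem aHalf q = q / 2) rfl rfl gc
    (by simp) ?_) fun τ _ h q hq => h q (by omega)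
  intro i _ τ _ hτ hI
  refine Runs.seq (Runs.store (Runs.store fun q hq => ?_))
  simp [hτ, Function.update_apply]
  split_ifs with h h'
  · omega
  · omega
  · exact hI q (by omega)

/-- Moves one bit from the rest of the code to the literal of sign `s` in the current cell. -/
def readBit (s : ℕ) : Prog :=
  seq (store aM (litE vJ vI (lit s))
    (sub (var vRest) (add (get aHalf (var vRest)) (get aHalf (var vRest)))))
    (assign vRest (get aHalf (var vRest)))

/-- Fills the first `vA` rows from the code `vC`. -/
def fill : Prog :=
  seq (assign vRest (var vC)) <| forUp vJ vA <| forUp vI vN <|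
    ite (get aShared (var vI)) (seq (readBit 0) (readBit 1))
      (seq (store aM (litE vJ vI (lit 0)) (get aNeg (var vI)))
        (store aM (litE vJ vI (lit 1)) (lit 0)))

/-- The tables that the search uses are in place, and `P` is the number of codes. -/
structure Tables (n m P : ℕ) (σ : State) : Prop where
  shared : ∀ i < n, σ.mem aShared i ≠ 0 ↔ Shared n m (σ.mem aZ) i
  neg : ∀ i < n, σ.mem aNeg i ≠ 0 ↔ NegAt n m (σ.mem aZ) (σ.mem aY) i
  codes : σ.var vCodes = P
  half : ∀ q < P, σ.mem aHalf q = q / 2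

theorem Tables.frame {n m P : ℕ} {σ τ : State} {p : Prog} (h : Tables n m P σ) (hF : Frame p σ τ)
    (hc : p.modVar vCodes = false) (hZ : p.modMem aZ = false) (hY : p.modMem aY = false)
    (hs : p.modMem aShared = false) (hn : p.modMem aNeg = false) (hh : p.modMem aHalf = false) :
    Tables n m P τ := by
  refine ⟨?_, ?_, ?_, ?_⟩
  · rw [hF.mem _ hs, hF.mem _ hZ]
    exact h.shared
  · rw [hF.mem _ hn, hF.mem _ hZ, hF.mem _ hY]
    exact h.neg
  · rw [hF.var _ hc, h.codes]
  · rw [hF.mem _ hh]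
    exact h.half

theorem runs_fill {P : ℕ} (hS : Setup n m k σ) (hT : Tables n m P σ) (ha : σ.var vA ≤ k)
    (hc : σ.var vC < P) (gn : n ≤ g) (gk : k ≤ g) :
    Runs env g fill σ fun τ =>
      Filled n m (σ.mem aZ) (σ.mem aY) (σ.var vC) (τ.mem aM) (n * σ.var vA) := by
  let R (T : ℕ) : ℕ := rest (fun t => Shared n m (σ.mem aZ) (t % n)) (σ.var vC) T
  let I (T : ℕ) (τ : State) : Prop := τ.var vRest = R T ∧
    Filled n m (σ.mem aZ) (σ.mem aY) (σ.var vC) (τ.mem aM) T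
  classical
  refine Runs.seq (Runs.assign ?_)
  refine Runs.mono (Runs.forUp (fun t => I (n * t)) rfl rfl (ha.trans gk)
    ⟨by simp [R, rest], fun t ht => by omega⟩ ?_) fun τ _ h => h.2
  intro j hj τ hF hτ hI
  have e : τ.var vN = n := by simp (disch := decide) [hF.var, hS.var_n]
  have hj : j < m + k := lt_of_lt_of_le hj (ha.trans (Nat.le_add_left _ _))
  refine Runs.mono (Runs.forUp (fun t => I (n * j + t)) rfl rfl (by rwa [e])
    hI ?_) fun υ _ h => by rw [e] at h; exact h
  intro i hi υ hG hυ hI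
  rw [e] at hi
  have hmod : (n * j + i) % n = i := by rw [Nat.mul_add_mod, Nat.mod_eq_of_lt hi]
  have eJ : υ.var vJ = j := by simp (disch := decide) [hG.var, hτ]
  have eMul : υ.mem aMul j = n * j := by simp (disch := decide) [hG.mem, hF.mem, hS.mul j hj]
  have eNeg : υ.mem aNeg = σ.mem aNeg := by simp (disch := decide) [hG.mem, hF.mem]
  have eS : υ.mem aShared = σ.mem aShared := by simp (disch := decide) [hG.mem, hF.mem]
  have eH (q : ℕ) (hq : q < P) : υ.mem aHalf q = q / 2 := by
    simp (disch := decide) [hG.mem, hF.mem, hT.half q hq]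
  have hlt : R (n * j + i) < P := (rest_le _ _ _).trans_lt hc
  have hsucc : R (n * j + i + 1) = if Shared n m (σ.mem aZ) i then
      R (n * j + i) / 2 / 2 else R (n * j + i) := by
    simp only [R, rest, hmod]
  refine Runs.ite (fun h => ?_) (fun h => ?_)
  · have hs : Shared n m (σ.mem aZ) i := (hT.shared i hi).1 (by simpa [hυ, eS] using h)
    refine Runs.seq (Runs.seq (Runs.store (Runs.assign (Runs.seq (Runs.store
      (Runs.assign ⟨?_, ?_⟩))))))
    · rw [← add_assoc, hsucc, if_pos hs]
      simp [hI.1, eH _ hlt, eH (R (n * j + i) / 2) (by omega)]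
    · rw [← add_assoc]
      refine Filled.succ (hI.2.congr fun q hq => ?_) (fun _ => ?_)
        (fun hns => absurd hs (by rwa [hmod] at hns))
      · simp [hυ, eJ, eMul, Function.update_apply]
        rw [if_neg (by omega), if_neg (by omega)]
      · change _ = R (n * j + i) % 2 ∧ _ = R (n * j + i) / 2 % 2
        simp [hυ, eJ, eMul, hI.1, eH _ hlt,
          eH (R (n * j + i) / 2) (by omega)]
        omega
  · have hs : ¬ Shared n m (σ.mem aZ) i := fun hs =>
      (hT.shared i hi).2 hs (by simpa [hυ, eS] using h)
    refine Runs.seq (Runs.store (Runs.store ⟨?_, ?_⟩))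
    · rw [← add_assoc, hsucc, if_neg hs]
      simpa using hI.1
    · rw [← add_assoc]
      refine Filled.succ (hI.2.congr fun q hq => ?_)
        (fun hns => absurd hns (by rwa [hmod])) (fun _ => ?_)
      · simp [hυ, eJ, eMul, Function.update_apply]
        rw [if_neg (by omega), if_neg (by omega)]
      · rw [hmod, ← hT.neg i hi]
        simp [hυ, eJ, eMul, eNeg]

/-- Gives a new row, its full description, to each positive sample that is not covered, while there
is room. -/
def complete : Prog :=
  forUp vP vM <| ite (get aY (var vP))
    (seq covers <| ite (var vCov) skip <| ite (lt (var vF) (var vK))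
      (seq
        (forUp vI vN <| seq
          (store aM (litE vF vI (lit 0)) (sub (lit 1) (sampleE vP vI)))
          (store aM (litE vF vI (lit 1)) (sampleE vP vI)))
        (assign vF (add (var vF) (lit 1))))
      skip)
    skip

theorem runs_complete (hS : Setup n m k σ) (ha : σ.var vF ≤ k) (gn : n ≤ g) (gk : k ≤ g)
    (gm : m ≤ g) :
    Runs env g complete σ fun τ => τ.var vF ≤ k ∧
      (Lucky n m k (σ.mem aZ) (σ.mem aY) (σ.mem aM) (σ.var vF) →
        Greedy n (σ.mem aZ) (σ.mem aY) (σ.mem aM) (σ.var vF) m (τ.var vF) (τ.mem aM)) := by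
  have hm := hS.var_m
  refine Runs.mono (Runs.forUp (fun t τ => τ.var vF ≤ k ∧
      (Lucky n m k (σ.mem aZ) (σ.mem aY) (σ.mem aM) (σ.var vF) →
        Greedy n (σ.mem aZ) (σ.mem aY) (σ.mem aM) (σ.var vF) t (τ.var vF) (τ.mem aM)))
    rfl rfl (by rwa [hm]) ⟨by simpa using ha, fun _ => by simpa using Greedy.init⟩ ?_)
    fun τ _ h => by rwa [hm] at h
  rintro p hp τ hF hτ ⟨hf, hI⟩
  rw [hm] at hp
  have hS' : Setup n m k τ := hS.frame hF rfl rfl rfl rfl rfl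
  have eY : τ.mem aY = σ.mem aY := by simp (disch := decide) [hF.mem]
  have eZ : τ.mem aZ = σ.mem aZ := by simp (disch := decide) [hF.mem]
  refine Runs.ite (fun hy => Runs.seq ?_) (fun hy => Runs.skip ⟨by simpa using hf, fun hL => ?_⟩)
  · have hy : σ.mem aY p ≠ 0 := by simpa [hτ, eY] using hy
    refine Runs.mono (runs_covers hS' (by rwa [hτ]) hf gn gk) fun υ hF' hcov => ?_
    rw [hτ, eZ] at hcov
    have eF : υ.var vF = τ.var vF := hF'.var _ rfl
    have eM : υ.mem aM = τ.mem aM := hF'.mem _ rfl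
    refine Runs.ite (fun hc => Runs.skip ⟨by simpa [eF] using hf, fun hL => ?_⟩) (fun hc => ?_)
    · simp only [State.var_setVar, State.mem_setVar, eF, eM]
      refine (hI hL).keep hL hp fun _ hu => ?_
      obtain ⟨j, hj, h⟩ := hcov.1 hc
      exact absurd h (hu j hj)
    · have hu : ∀ j < τ.var vF, ¬ RowCov n (τ.mem aM) (σ.mem aZ) j p := fun j hj h =>
        hcov.2 ⟨j, hj, h⟩ hc
      have eK : υ.var vK = k := by rw [hF'.var _ rfl, hS'.var_k]
      refine Runs.ite (fun hk => Runs.seq ?_) (fun hk => Runs.skip ⟨by simpa [eF] using hf, ?_⟩)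
      · have hk : τ.var vF < k := by simpa [eK, eF] using hk
        have eN : υ.var vN = n := by rw [hF'.var _ rfl, hS'.var_n]
        have h1 := hS.mul p (by omega)
        have h2 := hS.mul (τ.var vF) (by omega)
        refine Runs.mono (Runs.forUp (fun t ρ =>
          (∀ q < n * τ.var vF + n * τ.var vF, ρ.mem aM q = τ.mem aM q) ∧
          ∀ i < t, ρ.mem aM ((n * τ.var vF + i) + (n * τ.var vF + i)) =
              1 - σ.mem aZ (n * p + i) ∧
            ρ.mem aM ((n * τ.var vF + i) + (n * τ.var vF + i) + 1) = σ.mem aZ (n * p + i))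
          rfl rfl (by rwa [eN]) ⟨fun q _ => by simp [eM], by simp⟩ ?_) ?_
        · rintro i hi ρ hG hρ ⟨hold, hnew⟩
          have e1 : (cellE vF vI).eval ρ = n * τ.var vF + i := by
            simp (disch := decide) [hG.mem, hG.var, hF'.mem, hF'.var, hF.mem, hρ, h2]
          have e2 : (sampleE vP vI).eval ρ = σ.mem aZ (n * p + i) := by
            simp (disch := decide) [hG.mem, hG.var, hF'.mem, hF'.var, hF.mem, hρ, h1, hτ]
          have e3 (x y) : (sampleE vP vI).eval (ρ.setMem aM x y) = σ.mem aZ (n * p + i) ∧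
              (cellE vF vI).eval (ρ.setMem aM x y) = n * τ.var vF + i := by
            rw [← e1, ← e2]
            simp
          refine Runs.seq (Runs.store (Runs.store ⟨fun q hq => ?_, fun i' hi' => ?_⟩))
          · simp only [litE, Expr.eval, State.mem_setVar, State.mem_setMem, e1, e2, e3,
              Function.update_apply, if_true]
            rw [if_neg (by omega), if_neg (by omega), hold q hq]
          · simp only [litE, Expr.eval, State.mem_setVar, State.mem_setMem, e1, e2, e3,
              Function.update_apply, if_true]
            rcases Nat.lt_succ_iff_lt_or_eq.1 hi' with hi' | rfl
            · rw [if_neg (by omega), if_neg (by omega), if_neg (by omega), if_neg (by omega)]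
              exact hnew i' hi'
            · simp
        · rintro ρ hG ⟨hold, hnew⟩
          rw [eN] at hnew
          have eF' : ρ.var vF = τ.var vF := by rw [hG.var _ rfl, eF]
          refine Runs.assign ⟨by simp [eF']; omega, fun hL => ?_⟩
          simp only [State.var_setVar, State.mem_setVar, Expr.eval, eF']
          exact (hI hL).add hS.bit hy hu hold hnew
      · have hk : k ≤ τ.var vF := by simpa [eK, eF] using hk
        intro hL
        simp only [State.var_setVar, State.mem_setVar, eF, eM]
        exact (hI hL).keep hL hp fun _ _ => hk
  · have hy : σ.mem aY p = 0 := by simpa [hτ, eY] using hy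
    exact (hI hL).keep hL hp fun h => absurd hy h

/-- Raises `vFlag` if the first `vF` rows are not consistent with the samples. -/
def check : Prog :=
  seq (assign vFlag (lit 0)) <| forUp vP vM <| seq covers <|
    ite (eq (eq (var vCov) (lit 0)) (eq (get aY (var vP)) (lit 0))) skip (assign vFlag (lit 1))

theorem runs_check (hS : Setup n m k σ) (hf : σ.var vF ≤ k) (gn : n ≤ g) (gk : k ≤ g)
    (gm : m ≤ g) :
    Runs env g check σ fun τ => τ.var vFlag = 0 ↔
      Consistent n m (σ.mem aZ) (σ.mem aY) (σ.mem aM) (σ.var vF) := by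
  refine Runs.seq (Runs.assign ?_)
  refine Runs.mono (Runs.forAny (x := vFlag) (fun p => ¬ (σ.mem aY p ≠ 0 ↔
    ∃ j < σ.var vF, RowCov n (σ.mem aM) (σ.mem aZ) j p)) rfl rfl (by decide) ?_ ?_) ?_
  · simpa [hS.var_m] using gm
  · intro p hp τ hF hτ
    have hp : p < m := by simpa [hS.var_m] using hp
    have hS' : Setup n m k τ :=
      (hS.setVar (by decide) (by decide) (by decide)).frame hF rfl rfl rfl rfl rfl
    have eY : τ.mem aY = σ.mem aY := by simp (disch := decide) [hF.mem]
    have eZ : τ.mem aZ = σ.mem aZ := by simp (disch := decide) [hF.mem]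
    have eM : τ.mem aM = σ.mem aM := by simp (disch := decide) [hF.mem]
    have eF : τ.var vF = σ.var vF := by simp (disch := decide) [hF.var]
    refine Runs.seq (Runs.mono (runs_covers hS' (by rwa [hτ]) (by rwa [eF]) gn gk)
      fun υ hG hcov => ?_)
    rw [hτ, eZ, eM, eF] at hcov
    have eFlag : υ.var vFlag = τ.var vFlag := hG.var _ rfl
    have e : (eq (eq (var vCov) (lit 0)) (eq (get aY (var vP)) (lit 0))).eval υ =
        if (υ.var vCov = 0 ↔ σ.mem aY p = 0) then 1 else 0 := by
      simp (disch := decide) [hG.mem, hG.var, hτ, eY]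
      split_ifs <;> simp_all
    refine Runs.ite (fun h => Runs.skip ?_) (fun h => Runs.assign ?_)
    · rw [e] at h
      have h : υ.var vCov = 0 ↔ σ.mem aY p = 0 := by simpa using h
      have h' : σ.mem aY p ≠ 0 ↔ υ.var vCov ≠ 0 := not_congr h.symm
      rw [← hcov, eFlag]
      exact (or_iff_left (not_not.2 h')).symm
    · rw [e] at h
      have h : ¬ (υ.var vCov = 0 ↔ σ.mem aY p = 0) := by simpa using h
      rw [← hcov]
      exact iff_of_true (by simp) (Or.inr fun h' => h (not_iff_not.1 h').symm)
  · intro τ _ h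
    rw [← not_iff_not, ← ne_eq, h]
    simp only [Consistent, State.var_setVar, Expr.eval, hS.var_m]
    push Not
    simp

/-- Tries the code `vC` for `vA` rows, and raises `vDone` if this gives consistent rows. -/
def tryCode : Prog :=
  seq fill <| seq (assign vF (var vA)) <| seq complete <| seq check <|
    ite (var vFlag) skip (assign vDone (lit 1))

theorem runs_tryCode {P : ℕ} (hS : Setup n m k σ) (hT : Tables n m P σ) (ha : σ.var vA ≤ k)
    (hc : σ.var vC < P) (hd : σ.var vDone = 0) (gn : n ≤ g) (gk : k ≤ g) (gm : m ≤ g) :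
    Runs env g tryCode σ fun τ => τ.var vF ≤ k ∧
      (τ.var vDone ≠ 0 → Consistent n m (σ.mem aZ) (σ.mem aY) (τ.mem aM) (τ.var vF)) ∧
      ((∃ N, Consistent n m (σ.mem aZ) (σ.mem aY) N k) →
        (∀ M, Filled n m (σ.mem aZ) (σ.mem aY) (σ.var vC) M (n * σ.var vA) →
          Lucky n m k (σ.mem aZ) (σ.mem aY) M (σ.var vA)) → τ.var vDone ≠ 0) := by
  refine Runs.seq (Runs.mono (runs_fill hS hT ha hc gn gk) fun τ hF hfill => ?_)
  have eA : τ.var vA = σ.var vA := hF.var _ rfl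
  have hS1 : Setup n m k (τ.setVar vF (σ.var vA)) :=
    (hS.frame hF rfl rfl rfl rfl rfl).setVar (by decide) (by decide) (by decide)
  refine Runs.seq (Runs.assign ?_)
  rw [Expr.eval, eA]
  refine Runs.seq (Runs.mono (runs_complete hS1 (by simpa using ha) gn gk gm) fun υ hG hυ => ?_)
  have eZ : υ.mem aZ = σ.mem aZ := by simp (disch := decide) [hF.mem, hG.mem]
  have eY : υ.mem aY = σ.mem aY := by simp (disch := decide) [hF.mem, hG.mem]
  have eD : υ.var vDone = 0 := by simp (disch := decide) [hF.var, hG.var, hd]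
  simp only [State.mem_setVar, State.var_setVar, if_true, hF.mem aZ rfl, hF.mem aY rfl] at hυ
  refine Runs.seq (Runs.mono (runs_check (hS1.frame hG rfl rfl rfl rfl rfl) hυ.1 gn gk gm)
    fun ρ hH hρ => ?_)
  rw [eZ, eY] at hρ
  have eF : ρ.var vF = υ.var vF := hH.var _ rfl
  have eM : ρ.mem aM = υ.mem aM := hH.mem _ rfl
  have eD' : ρ.var vDone = 0 := by rw [hH.var _ rfl, eD]
  refine Runs.ite (fun h => Runs.skip ⟨by rw [eF]; exact hυ.1, absurd eD', ?_⟩)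
    (fun h => Runs.assign ⟨by simpa [eF] using hυ.1, ?_, by simp⟩)
  · rintro ⟨N, hN⟩ hL
    have hL := hL _ hfill
    exact absurd (hρ.2 ((hυ.2 hL).consistent hL hN)) h
  · intro _
    simpa [eF, eM] using hρ.1 h

/-- Searches for consistent rows; if the search is not successful, no rows are left. -/
def search : Prog :=
  seq (assign vDone (lit 0)) <| seq (assign vF (lit 0)) <|
    seq (assign vK1 (add (var vK) (lit 1))) <|
    seq (forUp vA vK1 <| forUp vC vCodes <| ite (var vDone) skip tryCode) <|
    ite (var vDone) skip (assign vF (lit 0))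

/-- The search succeeds if some attempt is successful. -/
theorem runs_search {P : ℕ} (hS : Setup n m k σ) (hT : Tables n m P σ) (gn : n ≤ g)
    (gk : k + 1 ≤ g) (gm : m ≤ g) (gP : P ≤ g) :
    Runs env g search σ fun τ => τ.var vF ≤ k ∧
      ((∃ N, Consistent n m (σ.mem aZ) (σ.mem aY) N k) →
        (∃ a ≤ k, ∃ c < P, ∀ M, Filled n m (σ.mem aZ) (σ.mem aY) c M (n * a) →
          Lucky n m k (σ.mem aZ) (σ.mem aY) M a) →
        Consistent n m (σ.mem aZ) (σ.mem aY) (τ.mem aM) (τ.var vF)) := by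
  let good (a c : ℕ) : Prop := (∃ N, Consistent n m (σ.mem aZ) (σ.mem aY) N k) ∧
    ∀ M, Filled n m (σ.mem aZ) (σ.mem aY) c M (n * a) →
      Lucky n m k (σ.mem aZ) (σ.mem aY) M a
  let I (G : Prop) (τ : State) : Prop := τ.var vF ≤ k ∧
    (τ.var vDone ≠ 0 → Consistent n m (σ.mem aZ) (σ.mem aY) (τ.mem aM) (τ.var vF)) ∧
    (G → τ.var vDone ≠ 0)
  refine Runs.seq (Runs.assign (Runs.seq (Runs.assign (Runs.seq (Runs.assign (Runs.seq ?_))))))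
  refine Runs.mono (Runs.forUp (fun t => I (∃ a < t, ∃ c < P, good a c)) rfl rfl ?_ ?_ ?_) ?_
  · simpa [hS.var_k] using gk
  · simp [I]
  · intro a ha τ hF hτ hI
    have ha : a ≤ k := by simpa [hS.var_k, Nat.lt_succ_iff] using ha
    have hS1 : Setup n m k τ := (((hS.setVar (by decide) (by decide) (by decide)).setVar
      (by decide) (by decide) (by decide)).setVar (by decide) (by decide) (by decide)).frame hF
      rfl rfl rfl rfl rfl
    have hT1 : Tables n m P τ := Tables.frame (σ := ((σ.setVar vDone _).setVar vF _).setVar vK1 _)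
      ⟨hT.shared, hT.neg, by simpa using hT.codes, hT.half⟩ hF rfl rfl rfl rfl rfl rfl
    have eP : τ.var vCodes = P := hT1.codes
    refine Runs.mono (Runs.forUp (fun t => I ((∃ a' < a, ∃ c < P, good a' c) ∨
      ∃ c < t, good a c)) rfl rfl (by rwa [eP]) (by simpa [I] using hI) ?_) fun υ _ h => ?_
    · intro c hc υ hG hυ hI
      have eZ : υ.mem aZ = σ.mem aZ := by simp (disch := decide) [hF.mem, hG.mem]
      have eY : υ.mem aY = σ.mem aY := by simp (disch := decide) [hF.mem, hG.mem]
      have eA : υ.var vA = a := by simp (disch := decide) [hG.var, hτ]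
      refine Runs.ite (fun hd => Runs.skip ?_) (fun hd => ?_)
      · have hd : υ.var vDone ≠ 0 := by simpa using hd
        simpa [I, hd] using ⟨hI.1, hI.2.1 hd⟩
      · have hd : υ.var vDone = 0 := by simpa using hd
        refine Runs.mono (runs_tryCode (hS1.frame hG rfl rfl rfl rfl rfl)
          (hT1.frame hG rfl rfl rfl rfl rfl rfl) (by rwa [eA]) (by rw [hυ]; rwa [eP] at hc) hd
          gn ((Nat.le_succ k).trans gk) gm) fun ρ _ h => ?_
        rw [eZ, eY, eA, hυ] at h
        refine ⟨by simpa using h.1, by simpa using h.2.1, ?_⟩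
        rintro (h' | ⟨c', hc', h'⟩)
        · exact absurd hd (hI.2.2 (Or.inl h'))
        · rcases Nat.lt_succ_iff_lt_or_eq.1 hc' with hc' | rfl
          · exact absurd hd (hI.2.2 (Or.inr ⟨c', hc', h'⟩))
          · simpa using h.2.2 h'.1 h'.2
    · rw [eP] at h
      refine ⟨by simpa using h.1, by simpa using h.2.1, ?_⟩
      rintro ⟨a', ha', h'⟩
      rcases Nat.lt_succ_iff_lt_or_eq.1 ha' with ha' | rfl
      · simpa using h.2.2 (Or.inl ⟨a', ha', h'⟩)
      · simpa using h.2.2 (Or.inr h')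
  · intro τ hF h
    have e : (((σ.setVar vDone ((lit 0).eval σ)).setVar vF
      ((lit 0).eval (σ.setVar vDone ((lit 0).eval σ)))).setVar vK1
      ((add (var vK) (lit 1)).eval ((σ.setVar vDone ((lit 0).eval σ)).setVar vF
      ((lit 0).eval (σ.setVar vDone ((lit 0).eval σ)))))).var vK1 = k + 1 := by
      simp [hS.var_k]
    rw [e] at h
    refine Runs.ite (fun hd => Runs.skip ⟨h.1, fun _ _ => h.2.1 hd⟩)
      (fun hd => Runs.assign ⟨by simp, ?_⟩)
    rintro hN ⟨a, ha, c, hc, hL⟩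
    exact absurd hd (h.2.2 ⟨a, Nat.lt_succ_of_le ha, c, hc, hN, hL⟩)

/-! ### The program: sampling, output, and the whole algorithm -/

/-- Writes the least number of multiples of variable `u` that reach variable `v` to variable
`w`. -/
def ceilDiv (u v w : ℕ) : Prog :=
  seq (assign w (lit 0)) <| seq (assign vAcc (lit 0)) <|
    loop (lt (var vAcc) (var v)) <|
      seq (assign vAcc (add (var vAcc) (var u))) (assign w (add (var w) (lit 1)))

theorem runs_ceilDiv {u v w : ℕ} (hu : u ≠ w) (hv : v ≠ w) (hua : u ≠ vAcc) (hva : v ≠ vAcc)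
    (hwa : w ≠ vAcc) (N : ℕ) (hN : ∀ i, i * σ.var u < σ.var v ↔ i < N) (gN : N ≤ g) :
    Runs env g (ceilDiv u v w) σ fun τ => τ.var w = N := by
  refine Runs.seq (Runs.assign (Runs.seq (Runs.assign ?_)))
  refine Runs.mono (Runs.loop (fun i τ => τ.var w = i ∧ τ.var vAcc = i * σ.var u ∧
    τ.var u = σ.var u ∧ τ.var v = σ.var v) N gN ?_ ?_ ?_) fun τ _ h => h.1
  · simp [hu, hv, hua, hva, hwa]
  · rintro i hi τ ⟨h1, h2, h3, h4⟩
    refine ⟨?_, Runs.seq (Runs.assign (Runs.assign ⟨?_, ?_, ?_, ?_⟩))⟩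
    · simp [h2, h4, (hN i).2 hi]
    · simp [hwa, h1]
    · simp [hwa.symm, h2, h3, add_mul]
    · simp [hu, hua, h3]
    · simp [hv, hva, h4]
  · rintro τ ⟨h1, h2, h3, h4⟩
    have := (hN N).not.2 (lt_irrefl N)
    simpa [h2, h4] using this

/-- Computes `⌈1 / ε⌉`, `⌈1 / δ⌉` and the number `⌈1 / ε⌉ * (k * (2 * n + 1) + ⌈1 / δ⌉)` of
samples. -/
def sampleSize : Prog :=
  seq (ceilDiv 3 4 vEps) <| seq (ceilDiv 5 6 vDelta) <|
    seq (assign vAcc (lit 0)) <|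
    seq (forUp vI vK <| assign vAcc (add (var vAcc) (add (add (var vN) (var vN)) (lit 1)))) <|
    seq (assign vAcc (add (var vAcc) (var vDelta))) <|
    seq (assign vM (lit 0)) <|
    seq (forUp vI vEps <| assign vM (add (var vM) (var vAcc))) <|
    assign vMK (add (var vM) (var vK))

theorem runs_sampleSize (E D : ℕ) (hE : ∀ i, i * σ.var 3 < σ.var 4 ↔ i < E)
    (hD : ∀ i, i * σ.var 5 < σ.var 6 ↔ i < D) (gE : E ≤ g) (gD : D ≤ g) (gk : σ.var vK ≤ g) :
    Runs env g sampleSize σ fun τ =>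
      τ.var vM = E * (σ.var vK * (2 * σ.var vN + 1) + D) ∧ τ.var vMK = τ.var vM + σ.var vK := by
  refine Runs.seq (Runs.mono (runs_ceilDiv (by decide) (by decide) (by decide) (by decide)
    (by decide) E hE gE) fun τ hF hτ => ?_)
  refine Runs.seq (Runs.mono (runs_ceilDiv (by decide) (by decide) (by decide) (by decide)
    (by decide) D (by simpa (disch := decide) [hF.var] using hD) gD) fun υ hG hυ => ?_)
  refine Runs.seq (Runs.assign (Runs.seq ?_))
  refine Runs.mono (Runs.forUp (fun t ρ => ρ.var vAcc = t * (2 * σ.var vN + 1)) rfl rfl ?_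
    (by simp) ?_) fun ρ hH hρ => ?_
  · simpa (disch := decide) [hF.var, hG.var] using gk
  · intro i _ ρ hH _ hρ
    refine Runs.assign ?_
    simp (disch := decide) [hH.var, hG.var, hF.var, hρ]
    ring
  refine Runs.seq (Runs.assign (Runs.seq (Runs.assign (Runs.seq ?_))))
  have eE : ρ.var vEps = E := by simp (disch := decide) [hH.var, hG.var, hτ]
  have eD : ρ.var vDelta = D := by simp (disch := decide) [hH.var, hυ]
  have eK : υ.var vK = σ.var vK := by simp (disch := decide) [hG.var, hF.var]
  simp only [State.var_setVar, eK] at hρ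
  refine Runs.mono (Runs.forUp (fun t μ => μ.var vM = t * (σ.var vK * (2 * σ.var vN + 1) + D))
    rfl rfl ?_ (by simp) ?_) fun μ hL hμ => ?_
  · simpa [eE] using gE
  · intro i _ μ hL _ hμ
    refine Runs.assign ?_
    simp (disch := decide) [hL.var, hμ, hρ, eD]
    ring
  · refine Runs.assign ?_
    simp (disch := decide) [hL.var, hμ, hH.var, hG.var, hF.var, hτ]

/-- Tabulates the multiples of `n`. -/
def tabulateMul : Prog :=
  seq (assign vAcc (lit 0)) <| forUp vP vMK <|
    seq (store aMul (var vP) (var vAcc)) (assign vAcc (add (var vAcc) (var vN)))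

theorem runs_tabulateMul (gm : σ.var vMK ≤ g) :
    Runs env g tabulateMul σ fun τ => ∀ j < σ.var vMK, τ.mem aMul j = σ.var vN * j := by
  refine Runs.seq (Runs.assign ?_)
  refine Runs.mono (Runs.forUp (fun t τ => τ.var vAcc = σ.var vN * t ∧
    ∀ j < t, τ.mem aMul j = σ.var vN * j) rfl rfl (by simpa using gm) (by simp) ?_)
    fun τ _ h => by simpa using h.2
  rintro i _ τ hF hτ ⟨h1, h2⟩
  refine Runs.seq (Runs.store (Runs.assign ⟨?_, fun j hj => ?_⟩))
  · simp (disch := decide) [h1, hF.var]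
    ring
  · rcases Nat.lt_succ_iff_lt_or_eq.1 hj with hj | rfl
    · simp [hτ, hj.ne, h2 j hj]
    · simp [hτ, h1]

/-- Draws the samples. Bit `i` of a stored sample says whether variable `i` has the value `vPos`,
and the stored label says whether the sample has label `vLab`. -/
def drawSamples : Prog :=
  forUp vP vM <| seq (draw aRaw vY) <|
    seq (store aY (var vP) (eq (var vY) (var vLab))) <|
    forUp vI vN <| store aZ (cellE vP vI) (eq (get aRaw (var vI)) (var vPos))

theorem runs_drawSamples (hn : σ.var vN = n) (hmul : ∀ j < σ.var vM, σ.mem aMul j = n * j)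
    (hd : σ.drawn = 0) (hz : ∀ q, σ.mem aZ q < 2) (gn : n ≤ g) (gm : σ.var vM ≤ g) :
    Runs env g drawSamples σ fun τ => τ.drawn = σ.var vM ∧ (∀ q, τ.mem aZ q < 2) ∧
      ∀ p < σ.var vM,
        τ.mem aY p = (if (env.label (env.sample p)).toNat = σ.var vLab then 1 else 0) ∧
        ∀ i : Fin n, τ.mem aZ (n * p + i) =
          if (env.sample p i).toNat = σ.var vPos then 1 else 0 := by
  let Y (p : ℕ) : ℕ := if (env.label (env.sample p)).toNat = σ.var vLab then 1 else 0
  let Z (p : ℕ) (i : Fin n) : ℕ := if (env.sample p i).toNat = σ.var vPos then 1 else 0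
  refine Runs.forUp (fun t τ => τ.drawn = t ∧ (∀ q, τ.mem aZ q < 2) ∧
    ∀ p < t, τ.mem aY p = Y p ∧ ∀ i : Fin n, τ.mem aZ (n * p + i) = Z p i) rfl rfl gm
    ⟨hd, hz, by simp⟩ ?_
  rintro p hp τ hF hτ ⟨h1, h2, h3⟩
  refine Runs.seq (Runs.draw (Runs.seq (Runs.store ?_)))
  have eN : τ.var vN = n := by rw [hF.var _ rfl, hn]
  have eMul : τ.mem aMul p = n * p := by rw [hF.mem _ rfl, hmul p hp]
  have ePos : τ.var vPos = σ.var vPos := hF.var _ rfl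
  have eLab : τ.var vLab = σ.var vLab := hF.var _ rfl
  set υ : State := (τ.draw env aRaw vY).setMem aY ((var vP).eval (τ.draw env aRaw vY))
    ((eq (var vY) (var vLab)).eval (τ.draw env aRaw vY)) with hυ
  have hvar (v : ℕ) (hv : v ≠ vY) : υ.var v = τ.var v := by
    simp [hυ, State.draw, hv]
  have hmem (a : ℕ) (ha : a ≠ aRaw) (ha' : a ≠ aY) : υ.mem a = τ.mem a := by
    simp [hυ, State.draw, ha, ha']
  have hraw (i : Fin n) : υ.mem aRaw i = (env.sample p i).toNat := by
    simp [hυ, State.draw, h1]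
  have hY (q : ℕ) : υ.mem aY q = if q = p then Y p else τ.mem aY q := by
    simp [hυ, State.draw, h1, hτ, Function.update_apply, eLab, Y]
  have hdrawn : υ.drawn = p + 1 := by simp [hυ, State.draw, h1]
  refine Runs.mono (Runs.forUp (fun t ρ => (∀ q, ρ.mem aZ q < 2) ∧
    (∀ q < n * p, ρ.mem aZ q = τ.mem aZ q) ∧
    ∀ i : Fin n, (i : ℕ) < t → ρ.mem aZ (n * p + i) = Z p i) rfl rfl ?_ ?_ ?_) ?_
  · rwa [hvar _ (by decide), eN]
  · simp [hmem aZ (by decide) (by decide), h2]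
  · rintro i hi ρ hG hρ ⟨h4, h5, h6⟩
    rw [hvar _ (by decide), eN] at hi
    have eP : ρ.var vP = p := by rw [hG.var _ rfl, hvar _ (by decide), hτ]
    have eMul' : ρ.mem aMul p = n * p := by rw [hG.mem _ rfl, hmem _ (by decide) (by decide), eMul]
    have e1 : (cellE vP vI).eval ρ = n * p + i := by simp [eP, eMul', hρ]
    have e2 : (eq (get aRaw (var vI)) (var vPos)).eval ρ = Z p ⟨i, hi⟩ := by
      have := hraw ⟨i, hi⟩
      rw [← hG.mem _ rfl] at this
      simp [hρ, this, Z, hG.var vPos rfl, hvar vPos (by decide), ePos]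
    refine Runs.store ?_
    rw [e1, e2]
    refine ⟨fun q => ?_, fun q hq => ?_, fun i' hi' => ?_⟩
    · simp only [State.mem_setVar, State.mem_setMem, if_true, Function.update_apply]
      split_ifs
      · simp only [Z]
        split_ifs <;> omega
      · exact h4 q
    · simp only [State.mem_setVar, State.mem_setMem, if_true, Function.update_apply]
      rw [if_neg (by omega), h5 q hq]
    · simp only [State.mem_setVar, State.mem_setMem, if_true, Function.update_apply]
      rcases Nat.lt_succ_iff_lt_or_eq.1 hi' with hi' | rfl
      · rw [if_neg (by omega), h6 i' hi']
      · rw [if_pos rfl]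
  · rintro ρ hG ⟨h4, h5, h6⟩
    refine ⟨?_, h4, fun q hq => ?_⟩
    · exact (hG.drawn rfl).trans hdrawn
    · rw [State.mem_setVar, hG.mem aY rfl, hY]
      rcases Nat.lt_succ_iff_lt_or_eq.1 hq with hq | rfl
      · rw [if_neg hq.ne]
        refine ⟨(h3 q hq).1, fun i => ?_⟩
        rw [h5 _ (cell_lt i.2 hq)]
        exact (h3 q hq).2 i
      · refine ⟨if_pos rfl, fun i => ?_⟩
        exact h6 i (by rw [hvar _ (by decide), eN]; exact i.2)

/-- The representation of a formula with `f` terms (clauses) on `n` variables, with matrix `B`. -/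
def encode (n f : ℕ) (B : ℕ → Bool) : List Bool :=
  List.replicate n true ++ false ::
    (List.replicate f true ++ false :: (List.range (2 * (n * f))).map B)

/-- The bits of the output: if `s = 1`, the signs of all literals are swapped. -/
def outBit (M : ℕ → ℕ) (s q : ℕ) : Bool :=
  decide (M (q / 2 + q / 2 + if q % 2 = 0 then s else 1 - s) ≠ 0)

/-- Writes the representation of the formula that consists of the first `vF` rows. -/
def output : Prog :=
  seq (forUp vI vN (emit (lit 1))) <| seq (emit (lit 0)) <|
    seq (forUp vJ vF (emit (lit 1))) <| seq (emit (lit 0)) <|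
    forUp vJ vF <| forUp vI vN <|
      seq (emit (get aM (litE vJ vI (var vSwap))))
        (emit (get aM (litE vJ vI (sub (lit 1) (var vSwap)))))

theorem runs_output (hS : Setup n m k σ) (hf : σ.var vF ≤ k) (hout : σ.out = []) (gn : n ≤ g)
    (gk : k ≤ g) :
    Runs env g output σ fun τ =>
      τ.out = encode n (σ.var vF) (outBit (σ.mem aM) (σ.var vSwap)) := by
  refine Runs.seq (Runs.mono (Runs.forUp (fun t τ => τ.out = List.replicate t true) rfl rfl
    (by rwa [hS.var_n]) (by simpa using hout) fun i _ τ _ _ h => Runs.emit ?_) fun τ hF hτ => ?_)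
  · simp [h, List.replicate_succ']
  rw [hS.var_n] at hτ
  refine Runs.seq (Runs.emit (Runs.seq ?_))
  have eF : τ.var vF = σ.var vF := hF.var _ rfl
  refine Runs.mono (Runs.forUp (fun t τ => τ.out = List.replicate n true ++ false ::
    List.replicate t true) rfl rfl (by simpa [eF] using hf.trans gk) (by simp [hτ])
    fun i _ τ _ _ h => Runs.emit ?_) fun υ hG hυ => ?_
  · simp [h, List.replicate_succ']
  have eF' : υ.var vF = σ.var vF := by simp (disch := decide) [hG.var, eF]
  simp only [eF] at hυ
  refine Runs.seq (Runs.emit ?_)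
  let pre : List Bool :=
    List.replicate n true ++ false :: (List.replicate (σ.var vF) true ++ [false])
  let B := outBit (σ.mem aM) (σ.var vSwap)
  refine Runs.mono (Runs.forUp (fun t ρ => ρ.out = pre ++ (List.range (2 * (n * t))).map B)
    rfl rfl (by simpa [eF'] using hf.trans gk) (by simp [hυ, pre]) ?_) fun ρ _ hρ => ?_
  · intro j hj ρ hH hρ hI
    have hj : j < σ.var vF := by simpa [eF'] using hj
    have hj' := hS.mul j (by omega)
    have eN : ρ.var vN = n := by
      simp (disch := decide) [hH.var, hG.var, hF.var, hS.var_n]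
    refine Runs.mono (Runs.forUp (fun t ρ => ρ.out = pre ++
      (List.range (2 * (n * j + t))).map B) rfl rfl (by rwa [eN]) (by simpa using hI) ?_)
      fun μ _ hμ => ?_
    · intro i hi μ hL hμ hI
      have e0 : (cellE vJ vI).eval μ = n * j + i := by
        simp (disch := decide) [hL.var, hL.mem, hH.mem, hG.mem, hF.mem, hμ, hρ, hj']
      have eM : μ.mem aM = σ.mem aM := by
        simp (disch := decide) [hL.mem, hH.mem, hG.mem, hF.mem]
      have eS : μ.var vSwap = σ.var vSwap := by
        simp (disch := decide) [hL.var, hH.var, hG.var, hF.var]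
      have e1 (l : List Bool) : (get aM (litE vJ vI (var vSwap))).eval { μ with out := l } =
          σ.mem aM ((n * j + i) + (n * j + i) + σ.var vSwap) := by
        rw [← e0, ← eM, ← eS]
        simp
      have e2 (l : List Bool) :
          (get aM (litE vJ vI (sub (lit 1) (var vSwap)))).eval { μ with out := l } =
          σ.mem aM ((n * j + i) + (n * j + i) + (1 - σ.var vSwap)) := by
        rw [← e0, ← eM, ← eS]
        simp
      have b1 : B (2 * (n * j + i)) =
          decide (σ.mem aM ((n * j + i) + (n * j + i) + σ.var vSwap) ≠ 0) := by
        simp [B, outBit]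
      have b2 : B (2 * (n * j + i) + 1) =
          decide (σ.mem aM ((n * j + i) + (n * j + i) + (1 - σ.var vSwap)) ≠ 0) := by
        have h : (2 * (n * j + i) + 1) / 2 = n * j + i := by omega
        simp [B, outBit, h]
      refine Runs.seq (Runs.emit (Runs.emit ?_))
      change (μ.out ++
        [decide ((get aM (litE vJ vI (var vSwap))).eval { μ with out := μ.out } ≠ 0)]) ++ _ = _
      rw [e1, e2, ← b1, ← b2, hI, show 2 * (n * j + (i + 1)) = 2 * (n * j + i) + 1 + 1 by ring,
        List.range_succ, List.range_succ]
      simp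
    · rw [eN] at hμ
      exact hμ
  · simp only [eF'] at hρ
    rw [hρ]
    simp [pre, B, encode]

/-- The learning algorithm. The constants are the value `b` that counts as `1` in samples, the label
of the positive samples, and whether the signs of literals are swapped in the output. -/
def learner (pos lab swap : ℕ) : Prog :=
  seq sampleSize <| seq tabulateMul <| seq (assign vPos (lit pos)) <|
    seq (assign vLab (lit lab)) <| seq (assign vSwap (lit swap)) <| seq drawSamples <|
    seq findShared <| seq findNeg <| seq countCodes <| seq tabulateHalves <| seq search output

open Classical in
/-- The algorithm draws `m` samples and writes a formula with at most `k` terms (clauses); its rows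
are consistent with the samples whenever some `k` rows are and at most `l` columns are shared. -/
theorem runs_learner (pos lab swap k l en ed dn dd E D m : ℕ)
    (hE : ∀ i, i * en < ed ↔ i < E) (hD : ∀ i, i * dn < dd ↔ i < D)
    (hm : m = E * (k * (2 * n + 1) + D)) (gn : n ≤ g) (gk : k + 1 ≤ g) (gl : l ≤ g) (gE : E ≤ g)
    (gD : D ≤ g) (gm : m + k ≤ g) (gP : 4 ^ (k * l) ≤ g) :
    Runs env g (learner pos lab swap) (State.init [n, k, l, en, ed, dn, dd]) fun τ =>
      τ.drawn = m ∧ ∃ f ≤ k, ∃ M Z Y : ℕ → ℕ, τ.out = encode n f (outBit M swap) ∧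
        (∀ p < m, Y p = (if (env.label (env.sample p)).toNat = lab then 1 else 0) ∧
          ∀ i : Fin n, Z (n * p + i) = if (env.sample p i).toNat = pos then 1 else 0) ∧
        ((∃ N, Consistent n m Z Y N k) → Nat.count (Shared n m Z) n ≤ l →
          Consistent n m Z Y M f) := by
  set σ := State.init [n, k, l, en, ed, dn, dd] with hσ
  have s0 : σ.var vN = n := rfl
  have s1 : σ.var vK = k := rfl
  have s2 : σ.var vL = l := rfl
  refine Runs.seq (Runs.mono (runs_sampleSize E D hE hD gE gD (by rw [s1]; omega))
    fun τ hF hτ => ?_)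
  rw [s0, s1, ← hm] at hτ
  have t0 : τ.var vN = n := hF.var _ rfl
  have t1 : τ.var vK = k := hF.var _ rfl
  have t2 : τ.var vL = l := hF.var _ rfl
  have t3 : τ.var vMK = m + k := by rw [hτ.2, hτ.1]
  refine Runs.seq (Runs.mono (runs_tabulateMul (by rwa [t3])) fun υ hG hυ => ?_)
  rw [t3, t0] at hυ
  refine Runs.seq (Runs.assign (Runs.seq (Runs.assign (Runs.seq (Runs.assign ?_)))))
  set ρ := ((υ.setVar vPos ((lit pos).eval υ)).setVar vLab _).setVar vSwap _ with hρ
  have r0 : ρ.var vN = n := by simp (disch := decide) [hρ, hG.var, t0]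
  have r1 : ρ.var vK = k := by simp (disch := decide) [hρ, hG.var, t1]
  have r2 : ρ.var vL = l := by simp (disch := decide) [hρ, hG.var, t2]
  have r3 : ρ.var vM = m := by simp (disch := decide) [hρ, hG.var, hτ.1]
  have r4 : ρ.var vPos = pos := by simp [hρ]
  have r5 : ρ.var vLab = lab := by simp [hρ]
  have r6 : ρ.var vSwap = swap := by simp [hρ]
  have r7 : ρ.drawn = 0 := by
    simp only [hρ, State.drawn_setVar]
    rw [hG.drawn rfl, hF.drawn rfl]
    rfl
  have r8 : ρ.out = [] := by
    simp only [hρ, State.out_setVar]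
    rw [hG.out rfl, hF.out rfl]
    rfl
  have r9 (q) : ρ.mem aZ q < 2 := by
    simp only [hρ, State.mem_setVar]
    rw [hG.mem _ rfl, hF.mem _ rfl]
    exact Nat.zero_lt_two
  have r10 : ∀ j < m + k, ρ.mem aMul j = n * j := hυ
  refine Runs.seq (Runs.mono (runs_drawSamples (env := env) r0
    (fun j hj => r10 j (by rw [r3] at hj; omega)) r7 r9 gn (by rw [r3]; omega))
    fun α hα hdraw => ?_)
  rw [r3, r4, r5] at hdraw
  have hS : Setup n m k α := ⟨by rw [hα.var _ rfl, r0], by rw [hα.var _ rfl, r1],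
    by rw [hα.var _ rfl, r3], by rw [hα.mem _ rfl]; exact r10, hdraw.2.1⟩
  refine Runs.seq (Runs.mono (runs_findShared hS gn (by omega)) fun β hβ hsh => ?_)
  have hSβ := hS.frame hβ rfl rfl rfl rfl rfl
  refine Runs.seq (Runs.mono (runs_findNeg hSβ gn (by omega)) fun γ hγ hneg => ?_)
  have hSγ := hSβ.frame hγ rfl rfl rfl rfl rfl
  have lγ : γ.var vL = l := by rw [hγ.var _ rfl, hβ.var _ rfl, hα.var _ rfl, r2]
  refine Runs.seq (Runs.mono (runs_countCodes (by rw [hSγ.var_k]; omega) (by rwa [lγ]))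
    fun μ hμ hcodes => ?_)
  rw [hSγ.var_k, lγ] at hcodes
  have hSμ := hSγ.frame hμ rfl rfl rfl rfl rfl
  refine Runs.seq (Runs.mono (runs_tabulateHalves (by rwa [hcodes])) fun ν hν hhalf => ?_)
  rw [hcodes] at hhalf
  have hSν := hSμ.frame hν rfl rfl rfl rfl rfl
  have eZ : ν.mem aZ = α.mem aZ := by
    rw [hν.mem _ rfl, hμ.mem _ rfl, hγ.mem _ rfl, hβ.mem _ rfl]
  have eY : ν.mem aY = α.mem aY := by
    rw [hν.mem _ rfl, hμ.mem _ rfl, hγ.mem _ rfl, hβ.mem _ rfl]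
  have hT : Tables n m (4 ^ (k * l)) ν := by
    refine ⟨?_, ?_, by rw [hν.var _ rfl, hcodes], hhalf⟩
    · rw [hν.mem _ rfl, hμ.mem _ rfl, hγ.mem _ rfl, eZ]
      exact hsh
    · rw [hν.mem aNeg rfl, hμ.mem aNeg rfl, eZ, eY]
      rw [hβ.mem aZ rfl, hβ.mem aY rfl] at hneg
      exact hneg
  refine Runs.seq (Runs.mono (runs_search hSν hT gn gk (by omega) gP) fun ξ hξ hsearch => ?_)
  rw [eZ, eY] at hsearch
  have hSξ := hSν.frame hξ rfl rfl rfl rfl rfl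
  have oξ : ξ.out = [] := by
    rw [hξ.out rfl, hν.out rfl, hμ.out rfl, hγ.out rfl, hβ.out rfl, hα.out rfl, r8]
  have wξ : ξ.var vSwap = swap := by
    rw [hξ.var _ rfl, hν.var _ rfl, hμ.var _ rfl, hγ.var _ rfl, hβ.var _ rfl, hα.var _ rfl, r6]
  refine Runs.mono (runs_output hSξ hsearch.1 oξ gn (by omega)) fun ω hω hout => ?_
  rw [wξ] at hout
  refine ⟨?_, ξ.var vF, hsearch.1, ξ.mem aM, α.mem aZ, α.mem aY, hout, hdraw.2.2,
    fun ⟨N, hN⟩ hl => hsearch.2 ⟨N, hN⟩ (exists_lucky hdraw.2.1 hN hl)⟩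
  rw [hω.drawn rfl, hξ.drawn rfl, hν.drawn rfl, hμ.drawn rfl, hγ.drawn rfl, hβ.drawn rfl, hdraw.1]

end Program

/-! ### Formulas and their representations -/

theorem numVars_encode (n f : ℕ) (B : ℕ → Bool) : numVars (encode n f B) = n :=
  leadingOnes_replicate _ _

theorem drop_encode (n f : ℕ) (B : ℕ → Bool) : (encode n f B).drop (n + 1) =
    List.replicate f true ++ false :: (List.range (2 * (n * f))).map B :=
  drop_replicate _ _

theorem numTerms_encode (n f : ℕ) (B : ℕ → Bool) : numTerms (encode n f B) = f := by
  rw [numTerms, numVars_encode, drop_encode]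
  exact leadingOnes_replicate _ _

theorem matrixPart_encode (n f : ℕ) (B : ℕ → Bool) :
    matrixPart (encode n f B) = (List.range (2 * (n * f))).map B := by
  rw [matrixPart, numTerms_encode, numVars_encode, drop_encode]
  exact drop_replicate _ _

/-- The value of a formula, read as a CNF formula if `cnf` is true and as a DNF formula
otherwise. -/
def evalForm (cnf : Bool) {n : ℕ} (φ : Formula n) (x : Fin n → Bool) : Bool :=
  bif cnf then evalCNF φ x else evalDNF φ x

theorem evalForm_congr (cnf : Bool) {n : ℕ} {φ ψ : Formula n} (h : ∀ P, P ∈ φ ↔ P ∈ ψ) :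
    evalForm cnf φ = evalForm cnf ψ := by
  funext x
  cases cnf <;> simp [evalForm, evalDNF, evalCNF, h]

/-- A DNF formula is true, and a CNF formula is false, at `x` if and only if some row of its
matrix avoids a certain half of the literals: in a DNF formula those that are false at `x`, in a
CNF formula those that are true. -/
theorem evalForm_decodeFormula (cnf : Bool) (r : List Bool) (x : Fin (numVars r) → Bool) :
    evalForm cnf (decodeFormula r) x = (!cnf) ↔ ∃ j < numTerms r, ∀ i : Fin (numVars r),
      (matrixPart r).getD (2 * (numVars r * j + i) + (xor cnf (!x i)).toNat) false = false := by
  have hmem (P) : P ∈ decodeFormula r ↔ ∃ j : Fin (numTerms r),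
      (Finset.univ.filter fun l : Literal (numVars r) =>
        (matrixPart r).getD (2 * (numVars r * j + l.1) + l.2.toNat) false = true) = P := by
    rw [decodeFormula, List.mem_ofFn]
  have hfin (p : ℕ → Prop) : (∃ j < numTerms r, p j) ↔ ∃ j : Fin (numTerms r), p j := by
    simp [Fin.exists_iff]
  rw [hfin]
  cases cnf
  · rw [show evalForm false (decodeFormula r) x = evalDNF (decodeFormula r) x from rfl, evalDNF,
      Bool.not_false, decide_eq_true_eq]
    simp only [hmem, exists_exists_eq_and, Finset.mem_filter, Finset.mem_univ, true_and,
      Prod.forall, Bool.false_xor]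
    refine exists_congr fun j => forall_congr' fun i => ?_
    refine ⟨fun h => ?_, fun h s hs => ?_⟩
    · by_contra hne
      have := h (!x i) (by simpa using hne)
      simp at this
    · by_contra hne
      have : s = !x i := by
        revert hne
        cases s <;> cases x i <;> decide
      rw [this, h] at hs
      exact absurd hs (by decide)
  · rw [show evalForm true (decodeFormula r) x = evalCNF (decodeFormula r) x from rfl, evalCNF,
      Bool.not_true, decide_eq_false_iff_not]
    simp only [hmem, forall_exists_index, forall_apply_eq_imp_iff, Finset.mem_filter,
      Finset.mem_univ, true_and, Prod.exists, Bool.true_xor, Bool.not_not, not_forall,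
      not_exists, not_and]
    refine exists_congr fun j => forall_congr' fun i => ?_
    refine ⟨fun h => ?_, fun h s hs hne => ?_⟩
    · by_contra hne
      exact h (x i) (by simpa using hne) rfl
    · rw [← hne, h] at hs
      exact absurd hs (by decide)

theorem exists_rho_eq (cnf b : Bool) {n : ℕ} {r : List Bool} (hr : numVars r = n) :
    ∃ h, (learningFormulas (evalForm cnf) b).rho r = ⟨n, h⟩ := by
  subst hr
  exact ⟨_, rfl⟩

theorem of_rho_eq {cnf b : Bool} {n : ℕ} {r : List Bool} {h : (Fin n → Bool) → Bool}
    (e : (learningFormulas (evalForm cnf) b).rho r = ⟨n, h⟩) :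
    (∃ φ : Formula n, φ.length = numTerms r ∧ h = evalForm cnf φ) ∧
      ∀ x, h x = (!cnf) ↔ ∃ j < numTerms r, ∀ i : Fin n,
        (matrixPart r).getD (2 * (n * j + i) + (xor cnf (!x i)).toNat) false = false := by
  obtain ⟨rfl, h'⟩ := Sigma.mk.inj_iff.1 e
  cases h'
  exact ⟨⟨decodeFormula r, by simp [decodeFormula], rfl⟩, evalForm_decodeFormula cnf r⟩

/-- The sign under which the algorithm looks up a literal, after the normalization of samples and
formulas, is the one under which the formula is evaluated. -/
theorem sign_lookup (cnf b v : Bool) :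
    (if 1 - (if v.toNat = b.toNat then 1 else 0) = 0 then (cnf == b).toNat
      else 1 - (cnf == b).toNat) = (xor cnf (!v)).toNat ∧
    (if (xor cnf (!v)).toNat = 0 then (cnf == b).toNat else 1 - (cnf == b).toNat) =
      1 - (if v.toNat = b.toNat then 1 else 0) := by
  cases cnf <;> cases b <;> cases v <;> decide

section Normalization

variable {cnf b : Bool} {n m k : ℕ} {c : (Fin n → Bool) → Bool} {x : ℕ → Fin n → Bool}
  {Z Y : ℕ → ℕ}

/-- Labeled samples of a formula with `k` terms (clauses) are consistent with some `k` rows. -/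
theorem exists_consistent {r : List Bool}
    (e : (learningFormulas (evalForm cnf) b).rho r = ⟨n, c⟩)
    (hx : ∀ p < m, Y p = (if (c (x p)).toNat = (!cnf).toNat then 1 else 0) ∧
      ∀ i : Fin n, Z (n * p + i) = if (x p i).toNat = b.toNat then 1 else 0) :
    ∃ N, Consistent n m Z Y N (numTerms r) := by
  let s := (cnf == b).toNat
  refine ⟨fun q => ((matrixPart r).getD (2 * (q / 2) + if q % 2 = 0 then s else 1 - s)
    false).toNat, fun p hp => ?_⟩
  have hY : Y p ≠ 0 ↔ c (x p) = (!cnf) := by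
    rw [(hx p hp).1]
    generalize c (x p) = y
    cases cnf <;> cases y <;> decide
  rw [hY, (of_rho_eq e).2]
  refine exists_congr fun j => and_congr_right fun _ => ?_
  rw [rowCov_iff]
  refine forall_congr' fun i => ?_
  rw [(hx p hp).2 i, ← (sign_lookup cnf b (x p i)).1]
  generalize hu : 1 - (if (x p i).toNat = b.toNat then 1 else 0) = u
  have h2 : u < 2 := by omega
  rw [show (n * j + i + (n * j + i) + u) / 2 = n * j + i by omega,
    show (n * j + i + (n * j + i) + u) % 2 = u by omega, Bool.toNat_eq_zero]

/-- A representation of consistent rows represents a concept that agrees with the labels. -/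
theorem Consistent.eq_label {M : ℕ → ℕ} {f : ℕ} (hM : Consistent n m Z Y M f)
    {h : (Fin n → Bool) → Bool}
    (e : (learningFormulas (evalForm cnf) b).rho
      (encode n f (outBit M (cnf == b).toNat)) = ⟨n, h⟩)
    (hx : ∀ p < m, Y p = (if (c (x p)).toNat = (!cnf).toNat then 1 else 0) ∧
      ∀ i : Fin n, Z (n * p + i) = if (x p i).toNat = b.toNat then 1 else 0)
    {p : ℕ} (hp : p < m) : h (x p) = c (x p) := by
  have hY : Y p ≠ 0 ↔ c (x p) = (!cnf) := by
    rw [(hx p hp).1]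
    generalize c (x p) = y
    cases cnf <;> cases y <;> decide
  have key : h (x p) = (!cnf) ↔ c (x p) = (!cnf) := by
    rw [← hY, hM p hp, (of_rho_eq e).2, numTerms_encode, matrixPart_encode]
    refine exists_congr fun j => and_congr_right fun hj => ?_
    rw [rowCov_iff]
    refine forall_congr' fun i => ?_
    have hu := (sign_lookup cnf b (x p i)).2
    generalize (xor cnf (!x p i)).toNat = u, Bool.toNat_lt (xor cnf (!x p i)) = h2 at hu
    have hlt : 2 * (n * j + i) + u < 2 * (n * f) := by
      have := cell_lt i.2 hj
      omega
    rw [List.getD_eq_getElem _ _ (by simpa using hlt)]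
    simp only [List.getElem_map, List.getElem_range, outBit]
    rw [show (2 * (n * j + i) + u) / 2 = n * j + i by omega,
      show (2 * (n * j + i) + u) % 2 = u by omega, hu, (hx p hp).2 i]
    simp
  revert key
  generalize h (x p) = y
  generalize c (x p) = y'
  cases cnf <;> cases y <;> cases y' <;> simp

open Classical in
/-- Only columns in `V` are set to `b` by two distinct assignments, so the shared columns are at
most as many as the parameter of the distribution allows. -/
theorem count_shared_le (D : PMF (Fin n → Bool)) (hD : ∀ p < m, x p ∈ D.support)
    (hx : ∀ p < m, ∀ i : Fin n, Z (n * p + i) = if (x p i).toNat = b.toNat then 1 else 0) :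
    Nat.count (Shared n m Z) n ≤ fewOutsideParam b n D := by
  have hne : {s | ∃ V : Finset (Fin n), V.card = s ∧ FewOutside b D.support V}.Nonempty :=
    ⟨_, Finset.univ, rfl, fun _ _ i hi => absurd (Finset.mem_univ i) hi,
      fun i hi => absurd (Finset.mem_univ i) hi⟩
  obtain ⟨V, hV, -, h2⟩ := Nat.sInf_mem hne
  change V.card = fewOutsideParam b n D at hV
  rw [← hV, Nat.count_eq_card_filter_range]
  refine (Finset.card_le_card fun i hi => ?_).trans (Finset.card_image_le (f := Fin.val))
  obtain ⟨hin, p, hp, hzp, q, hq, hzq, j, hj, hpq⟩ := Finset.mem_filter.1 hi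
  have hin := Finset.mem_range.1 hin
  refine Finset.mem_image.2 ⟨⟨i, hin⟩, ?_, rfl⟩
  by_contra hi
  have hinj : ∀ a b : Bool, a.toNat = b.toNat → a = b := by decide
  have hb {p} (hp : p < m) (hz : Z (n * p + i) ≠ 0) : x p ⟨i, hin⟩ = b := by
    rw [hx p hp ⟨i, hin⟩] at hz
    exact hinj _ _ (by simpa using hz)
  have := h2 _ hi _ (hD p hp) _ (hD q hq) (hb hp hzp) (hb hq hzq)
  rw [hx p hp ⟨j, hj⟩, hx q hq ⟨j, hj⟩, this] at hpq
  exact hpq rfl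

end Normalization

/-! ### Sample complexity -/

open Classical in
/-- The concepts that are given by formulas with at most `k` terms (clauses). -/
noncomputable def smallConcepts (cnf : Bool) (n k : ℕ) : Finset ((Fin n → Bool) → Bool) :=
  Finset.univ.filter fun h => ∃ φ : Formula n, φ.length ≤ k ∧ h = evalForm cnf φ

theorem mem_smallConcepts {cnf : Bool} {n k : ℕ} {h : (Fin n → Bool) → Bool} :
    h ∈ smallConcepts cnf n k ↔ ∃ φ : Formula n, φ.length ≤ k ∧ h = evalForm cnf φ := by
  simp [smallConcepts]

theorem card_smallConcepts_le (cnf : Bool) (n k : ℕ) :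
    (smallConcepts cnf n k).card ≤ 2 ^ (k * (2 * n + 1)) := by
  classical
  -- Lists of at most `k` terms are padded with `none`.
  let F (g : Fin k → Option (Finset (Literal n))) : (Fin n → Bool) → Bool :=
    evalForm cnf (List.ofFn g).reduceOption
  have hsub : smallConcepts cnf n k ⊆ Finset.univ.image F := by
    intro h hh
    obtain ⟨φ, hφ, rfl⟩ := mem_smallConcepts.1 hh
    refine Finset.mem_image.2 ⟨fun i => φ[(i : ℕ)]?, Finset.mem_univ _, ?_⟩
    refine evalForm_congr cnf fun P => ?_
    rw [List.reduceOption_mem_iff, List.mem_ofFn, List.mem_iff_getElem?]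
    refine ⟨fun ⟨i, hi⟩ => ⟨i, hi⟩, fun ⟨i, hi⟩ => ?_⟩
    have : i < φ.length := by
      by_contra hle
      rw [List.getElem?_eq_none (not_lt.1 hle)] at hi
      exact absurd hi (by simp)
    exact ⟨⟨i, this.trans_le hφ⟩, hi⟩
  calc (smallConcepts cnf n k).card
      ≤ (Finset.univ : Finset (Fin k → Option (Finset (Literal n)))).card :=
        (Finset.card_le_card hsub).trans Finset.card_image_le
    _ = (2 ^ (n * 2) + 1) ^ k := by simp
    _ ≤ (2 ^ (2 * n + 1)) ^ k := by
        refine Nat.pow_le_pow_left ?_ k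
        rw [pow_succ, mul_comm n 2]
        have := Nat.one_le_two_pow (n := 2 * n)
        omega
    _ = 2 ^ (k * (2 * n + 1)) := by rw [← pow_mul, mul_comm]

/-- If a set has probability at most `1 - ε`, the probability that `m` samples fall into it is at
most `(1 - ε) ^ m`. -/
theorem infinitePi_forall_lt {α : Type*} [MeasurableSpace α] (μ : Measure α)
    [IsProbabilityMeasure μ] {s : Set α} (hs : MeasurableSet s) (m : ℕ) :
    (Measure.infinitePi fun _ : ℕ => μ).real {x | ∀ p < m, x p ∈ s} = μ.real s ^ m := by
  have e : {x : ℕ → α | ∀ p < m, x p ∈ s} = Set.pi (Finset.range m) fun _ => s := by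
    ext x
    simp [Set.mem_pi]
  rw [e, measureReal_def, Measure.infinitePi_pi _ fun _ _ => hs]
  simp [measureReal_def]

/-- The union bound: it is unlikely that a concept in `H` whose error is more than `ε` agrees with
`c` on `m` samples. -/
theorem infinitePi_exists_agree_le {α : Type*} [MeasurableSpace α] [Finite α]
    [MeasurableSingletonClass α] (μ : Measure α) [IsProbabilityMeasure μ] (H : Finset (α → Bool))
    (c : α → Bool) {ε : ℝ} (hε : ε ≤ 1) (m : ℕ) :
    (Measure.infinitePi fun _ : ℕ => μ).real
      {x | ∃ h ∈ H, ε < μ.real {a | h a ≠ c a} ∧ ∀ p < m, h (x p) = c (x p)} ≤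
        H.card * (1 - ε) ^ m := by
  classical
  have e : {x : ℕ → α | ∃ h ∈ H, ε < μ.real {a | h a ≠ c a} ∧ ∀ p < m, h (x p) = c (x p)} =
      ⋃ h ∈ H.filter fun h => ε < μ.real {a | h a ≠ c a},
        {x | ∀ p < m, x p ∈ {a | h a = c a}} := by
    ext x
    simp [and_assoc]
  rw [e]
  refine (measureReal_biUnion_finset_le _ _).trans ?_
  refine (Finset.sum_le_card_nsmul _ _ ((1 - ε) ^ m) fun h hh => ?_).trans ?_
  · have hms : MeasurableSet {a | h a = c a} := (Set.toFinite _).measurableSet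
    rw [infinitePi_forall_lt μ hms]
    refine pow_le_pow_left₀ measureReal_nonneg ?_ m
    have h1 := (Finset.mem_filter.1 hh).2
    have h2 : {a | h a ≠ c a} = {a | h a = c a}ᶜ := rfl
    rw [h2, probReal_compl_eq_one_sub hms] at h1
    linarith
  · rw [nsmul_eq_mul]
    refine mul_le_mul_of_nonneg_right ?_ (pow_nonneg (by linarith) _)
    exact_mod_cast Finset.card_filter_le _ _

/-- So many samples suffice for a union bound over `2 ^ K` concepts. -/
theorem two_pow_mul_le {ε δ : ℝ} (hε : 0 < ε) (hε1 : ε ≤ 1) (hδ : 0 < δ) {E D : ℕ}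
    (hE : 1 / ε ≤ E) (hD : 1 / δ ≤ D) (K : ℕ) :
    2 ^ K * (1 - ε) ^ (E * (K + D)) ≤ δ := by
  -- Each block of `E` factors halves the bound; `K` blocks cancel the number of concepts.
  have hhalf : (1 - ε) ^ E ≤ 1 / 2 := by
    have h1 : 1 ≤ E * ε := by rwa [div_le_iff₀ hε] at hE
    calc (1 - ε) ^ E ≤ Real.exp (-ε) ^ E :=
          pow_le_pow_left₀ (by linarith) (Real.one_sub_le_exp_neg ε) E
      _ = Real.exp (-(E * ε)) := by rw [← Real.exp_nat_mul]; ring_nf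
      _ ≤ Real.exp (-1) := Real.exp_le_exp.2 (by linarith)
      _ ≤ 1 / 2 := by
          rw [Real.exp_neg, ← one_div]
          refine one_div_le_one_div_of_le (by norm_num) ?_
          have := Real.add_one_le_exp 1
          linarith
  have hD' : (1 / 2 : ℝ) ^ D ≤ δ := by
    have h2 : (D : ℝ) ≤ 2 ^ D := by exact_mod_cast Nat.lt_two_pow_self.le
    rw [one_div, inv_pow]
    exact inv_le_of_inv_le₀ hδ (by rw [← one_div]; linarith)
  calc 2 ^ K * (1 - ε) ^ (E * (K + D)) ≤ 2 ^ K * (1 / 2) ^ (K + D) := by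
        rw [pow_mul]
        gcongr
    _ = (1 / 2) ^ D := by rw [pow_add, ← mul_assoc, ← mul_pow]; norm_num
    _ ≤ δ := hD'

/-- Samples from `D` are almost surely in the support of `D`. -/
theorem ae_mem_support {n : ℕ} (D : PMF (Fin n → Bool)) :
    ∀ᵐ x ∂(Measure.infinitePi fun _ : ℕ => D.toMeasure), ∀ p, x p ∈ D.support := by
  rw [ae_all_iff]
  intro p
  have h : ∀ᵐ a ∂D.toMeasure, a ∈ D.support := by
    rw [ae_iff, PMF.toMeasure_apply_eq_zero_iff _ (Set.toFinite _).measurableSet]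
    exact Set.disjoint_left.2 fun a ha hna => hna ha
  exact (measurePreserving_eval_infinitePi (fun _ : ℕ => D.toMeasure) p).quasiMeasurePreserving.ae h

/-- With probability at least `1 - δ`, all samples lie in the support of `D`, and each small
concept that agrees with `c` on the first `m` of them has error at most `ε`. -/
theorem one_sub_le_runLaw {cnf : Bool} {n k E Δ : ℕ} (D : PMF (Fin n → Bool))
    (c : (Fin n → Bool) → Bool) {ε δ : ℝ} (hε : 0 < ε) (hε1 : ε ≤ 1) (hδ : 0 < δ)
    (hE : 1 / ε ≤ E) (hΔ : 1 / δ ≤ Δ)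
    {A : Set ((ℕ → (Fin n → Bool)) × (ℕ → Bool))}
    (hA : ∀ ω : (ℕ → (Fin n → Bool)) × (ℕ → Bool), (∀ p, ω.1 p ∈ D.support) →
      (∀ h ∈ smallConcepts cnf n k, (∀ p < E * (k * (2 * n + 1) + Δ), h (ω.1 p) = c (ω.1 p)) →
        D.toMeasure.real {x | h x ≠ c x} ≤ ε) → ω ∈ A) :
    1 - δ ≤ (runLaw D).real A := by
  have : IsProbabilityMeasure (runLaw D) := by
    unfold runLaw
    infer_instance
  set m := E * (k * (2 * n + 1) + Δ) with hm
  let bad : Set (ℕ → (Fin n → Bool)) := {x | ∃ h ∈ smallConcepts cnf n k,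
    ε < D.toMeasure.real {a | h a ≠ c a} ∧ ∀ p < m, h (x p) = c (x p)}
  let out : Set (ℕ → (Fin n → Bool)) := {x | ¬ ∀ p, x p ∈ D.support}
  have hfst (s : Set (ℕ → (Fin n → Bool))) : (runLaw D).real (Prod.fst ⁻¹' s) =
      (Measure.infinitePi fun _ : ℕ => D.toMeasure).real s := by
    rw [← Set.prod_univ, runLaw, measureReal_prod_prod]
    simp
  have hbad : (runLaw D).real (Prod.fst ⁻¹' bad) ≤ δ := by
    rw [hfst]
    refine (infinitePi_exists_agree_le D.toMeasure _ c hε1 m).trans ?_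
    refine le_trans ?_ (two_pow_mul_le hε hε1 hδ hE hΔ (k * (2 * n + 1)))
    rw [← hm]
    refine mul_le_mul_of_nonneg_right ?_ (pow_nonneg (by linarith) _)
    exact_mod_cast card_smallConcepts_le cnf n k
  have hout : (runLaw D).real (Prod.fst ⁻¹' out) = 0 := by
    rw [hfst, measureReal_def]
    have : (Measure.infinitePi fun _ : ℕ => D.toMeasure) out = 0 := ae_iff.1 (ae_mem_support D)
    rw [this]
    rfl
  have hcov : Set.univ ⊆ A ∪ (Prod.fst ⁻¹' bad ∪ Prod.fst ⁻¹' out) := by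
    intro ω _
    by_cases h1 : ω.1 ∈ out
    · exact Or.inr (Or.inr h1)
    by_cases h2 : ω.1 ∈ bad
    · exact Or.inr (Or.inl h2)
    refine Or.inl (hA ω (not_not.1 h1) fun h hh hag => ?_)
    by_contra hlt
    exact h2 ⟨h, hh, not_le.1 hlt, hag⟩
  have h1 := measureReal_mono (μ := runLaw D) hcov
  rw [probReal_univ] at h1
  have h2 := measureReal_union_le (μ := runLaw D) A (Prod.fst ⁻¹' bad ∪ Prod.fst ⁻¹' out)
  have h3 := measureReal_union_le (μ := runLaw D) (Prod.fst ⁻¹' bad) (Prod.fst ⁻¹' out)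
  linarith

/-! ### Resource bounds -/

/-- The number of samples. -/
def sampleBound : Bound := fun (n, _, x, y, k, _) => ⌈x⌉₊ * (k * (2 * n + 1) + ⌈y⌉₊)

/-- A common bound for the numbers of iterations of all loops. -/
def loopBound : Bound := fun (n, s, x, y, k, l) =>
  n + (k + 1) + l + ⌈x⌉₊ + ⌈y⌉₊ + (sampleBound (n, s, x, y, k, l) + k) + 4 ^ (k * l)

/-- The running time, up to a constant factor, of a program of depth `d` with these loops. -/
def stepBound (d : ℕ) : Bound := fun a => (a.1 + loopBound a + 1) ^ d

theorem sampleBound_mono : Monotone sampleBound := by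
  rintro ⟨n, s, x, y, k, l⟩ ⟨n', s', x', y', k', l'⟩ ⟨hn, -, hx, hy, hk, -⟩
  simp only at hn hx hy hk
  simp only [sampleBound]
  gcongr

theorem loopBound_mono : Monotone loopBound := by
  rintro ⟨n, s, x, y, k, l⟩ ⟨n', s', x', y', k', l'⟩ h
  have hm := sampleBound_mono h
  obtain ⟨hn, -, hx, hy, hk, hl⟩ := h
  simp only at hn hx hy hk hl
  simp only [loopBound]
  gcongr
  norm_num

theorem stepBound_mono (d : ℕ) : Monotone (stepBound d) := fun _ _ h =>
  Nat.pow_le_pow_left (Nat.add_le_add_right (Nat.add_le_add h.1 (loopBound_mono h)) 1) d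

theorem ceil_le_add_one {x : ℚ} (hx : 1 ≤ x) : (⌈x⌉₊ : ℚ) ≤ x + 1 :=
  (Nat.ceil_lt_add_one (by linarith)).le

theorem sampleBound_isPoly : sampleBound.IsPoly := by
  refine ⟨(.X 2 + 1) * (.X 4 * (2 * .X 0 + 1) + (.X 3 + 1)), fun n s x y k l hx hy => ?_⟩
  have h1 := ceil_le_add_one hx
  have h2 := ceil_le_add_one hy
  have e : MvPolynomial.aeval ![(n : ℚ), (s : ℚ), x, y, (k : ℚ), (l : ℚ)]
      ((.X 2 + 1) * (.X 4 * (2 * .X 0 + 1) + (.X 3 + 1)) : MvPolynomial (Fin 6) ℕ) =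
      (x + 1) * (k * (2 * n + 1) + (y + 1)) := by
    simp
  rw [e]
  simp only [sampleBound]
  push_cast
  gcongr

/-- The factor of the time bound that depends on the parameters. -/
def paramFactor (d : ℕ) (p : ℕ × ℕ) : ℕ := (p.1 + p.2 + 4 ^ (p.1 * p.2)) ^ d

theorem paramFactor_mono (d : ℕ) : Monotone (paramFactor d) := by
  rintro ⟨k, l⟩ ⟨k', l'⟩ ⟨hk, hl⟩
  simp only at hk hl
  simp only [paramFactor]
  gcongr
  norm_num

theorem paramFactor_computable (d : ℕ) : Computable (paramFactor d) := by
  have hpow : Primrec₂ fun a b : ℕ => a ^ b :=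
    Primrec₂.unpaired'.1 Nat.Primrec.pow
  have hadd := Primrec.nat_add.comp Primrec.fst (Primrec.snd (α := ℕ) (β := ℕ))
  have hmul := Primrec.nat_mul.comp Primrec.fst (Primrec.snd (α := ℕ) (β := ℕ))
  exact (hpow.comp (Primrec.nat_add.comp hadd (hpow.comp (Primrec.const 4) hmul))
    (Primrec.const d)).to_comp

theorem stepBound_isFPT (d : ℕ) : (stepBound d).IsFPT := by
  refine ⟨paramFactor d, paramFactor_computable d, paramFactor_mono d,
    (2 * .X 0 + 2 + (2 + 1 + (.X 2 + 1) + (.X 3 + 1) +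
      (.X 2 + 1) * ((2 * .X 0 + 1) + (.X 3 + 1)) + 1)) ^ d, fun n s x y k l hx hy => ?_⟩
  have h1 := ceil_le_add_one hx
  have h2 := ceil_le_add_one hy
  have e : MvPolynomial.aeval ![(n : ℚ), (s : ℚ), x, y]
      ((2 * .X 0 + 2 + (2 + 1 + (.X 2 + 1) + (.X 3 + 1) +
      (.X 2 + 1) * ((2 * .X 0 + 1) + (.X 3 + 1)) + 1)) ^ d : MvPolynomial (Fin 4) ℕ) =
      (2 * n + 2 + (2 + 1 + (x + 1) + (y + 1) +
        (x + 1) * ((2 * n + 1) + (y + 1)) + 1)) ^ d := by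
    simp
  rw [e, stepBound, paramFactor]
  push_cast
  rw [← mul_pow]
  refine pow_le_pow_left₀ (by positivity) ?_ d
  simp only [loopBound, sampleBound]
  push_cast
  -- The factor `F` is at least `1` and at least each term that involves `k` or `l`.
  set F : ℚ := k + l + 4 ^ (k * l) with hF
  have hP : (1 : ℚ) ≤ 4 ^ (k * l) := one_le_pow₀ (by norm_num)
  have hk0 : (0 : ℚ) ≤ k := by positivity
  have hl0 : (0 : ℚ) ≤ l := by positivity
  have hn0 : (0 : ℚ) ≤ n := by positivity
  have hk : (k : ℚ) ≤ F := by linarith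
  have hl : (l : ℚ) ≤ F := by linarith
  have hP' : (4 : ℚ) ^ (k * l) ≤ F := by linarith
  have hF1 : 1 ≤ F := by linarith
  have hs {c : ℚ} (hc : 0 ≤ c) : c ≤ F * c := le_mul_of_one_le_left hc hF1
  have hm : (⌈x⌉₊ : ℚ) * (k * (2 * n + 1) + ⌈y⌉₊) ≤
      F * ((x + 1) * ((2 * n + 1) + (y + 1))) := by
    calc (⌈x⌉₊ : ℚ) * (k * (2 * n + 1) + ⌈y⌉₊)
        ≤ (x + 1) * (F * (2 * n + 1) + F * (y + 1)) := by
          gcongr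
          exact h2.trans (hs (by linarith))
      _ = _ := by ring
  have a1 := hs (c := 2 * n + 2) (by positivity)
  have a2 := hs (c := x + 1) (by linarith)
  have a3 := hs (c := y + 1) (by linarith)
  linarith

/-! ### The learning theorem -/

/-- Counting multiples of the numerator up to the denominator yields `⌈1 / ε⌉`. -/
theorem mul_num_lt_den_iff {ε : ℚ} (hε : 0 < ε) (i : ℕ) :
    i * ε.num.toNat < ε.den ↔ i < ⌈1 / ε⌉₊ := by
  have hnum : ((ε.num.toNat : ℕ) : ℚ) = ε.num := by
    exact_mod_cast Int.toNat_of_nonneg (Rat.num_pos.2 hε).le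
  have hden : (0 : ℚ) < ε.den := by exact_mod_cast ε.den_pos
  rw [Nat.lt_ceil, lt_div_iff₀ hε, ← Nat.cast_lt (α := ℚ)]
  push_cast
  rw [hnum]
  conv_rhs => rw [← Rat.num_div_den ε, ← mul_div_assoc, div_lt_one hden]

theorem learningFormulas_mem (cnf b : Bool) :
    learningFormulas (evalForm cnf) b ∈ FPTPACTime := by
  let A := learner b.toNat (!cnf).toNat (cnf == b).toNat
  refine ⟨stepBound A.depth, sampleBound, stepBound_mono _, sampleBound_mono, stepBound_isFPT _,
    sampleBound_isPoly, A, A.size + 1, ?_⟩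
  intro n c r hr D ε δ hε hε1 hδ hδ1 k l hk hl start args
  have hk : k = numTerms r := hk.trans (csInf_Ici (a := numTerms r))
  have hl : l = fewOutsideParam b n D := hl
  have hpow : 0 < 4 ^ (k * l) := Nat.pow_pos (by norm_num)
  have hrun (x : ℕ → (Fin n → Bool)) (coin : ℕ → Bool) :=
    runs_learner (env := ⟨x, c, coin⟩) (g := loopBound args) b.toNat (!cnf).toNat
      (cnf == b).toNat k l ε.num.toNat ε.den δ.num.toNat δ.den ⌈1 / ε⌉₊ ⌈1 / δ⌉₊
      (sampleBound args) (mul_num_lt_den_iff hε) (mul_num_lt_den_iff hδ) rfl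
      (by simp only [loopBound, args]; omega) (by simp only [loopBound, args]; omega)
      (by simp only [loopBound, args]; omega) (by simp only [loopBound, args]; omega)
      (by simp only [loopBound, args]; omega) (by simp only [loopBound, args]; omega)
      (by simp only [loopBound, args]; omega)
  constructor
  · intro x coin _
    obtain ⟨t, σ, hexec, ht, hdrawn, f, hf, M, Z, Y, hout, -⟩ := hrun x coin
    refine ⟨t, σ, hexec, ht.trans ?_, ?_, ?_, ?_⟩
    · refine (Prog.timeBound_le n _ A).trans (Nat.mul_le_mul_right _ A.size.le_succ)
    · rw [hdrawn]
      exact Nat.le_mul_of_pos_left _ A.size.succ_pos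
    · change numTerms σ.out ≤ k
      rw [hout, numTerms_encode]
      exact hf
    · change numVars σ.out = n
      rw [hout, numVars_encode]
  · refine one_sub_le_runLaw (cnf := cnf) (k := k) D c (ε := (ε : ℝ)) (δ := (δ : ℝ))
      (by exact_mod_cast hε)
      (by exact_mod_cast hε1) (by exact_mod_cast hδ) (E := ⌈1 / ε⌉₊) (Δ := ⌈1 / δ⌉₊)
      (by exact_mod_cast Nat.le_ceil (1 / ε)) (by exact_mod_cast Nat.le_ceil (1 / δ)) ?_
    rintro ⟨x, coin⟩ hx hsmall
    obtain ⟨t, σ, hexec, -, -, f, hf, M, Z, Y, hout, hZY, hcons⟩ := hrun x coin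
    obtain ⟨h, hh⟩ := exists_rho_eq cnf b (r := σ.out) (n := n) (by rw [hout, numVars_encode])
    refine ⟨t, σ, hexec, h, hh, hsmall h ?_ ?_⟩
    · obtain ⟨⟨φ, hφ, rfl⟩, -⟩ := of_rho_eq hh
      refine mem_smallConcepts.2 ⟨φ, ?_, rfl⟩
      rw [hφ, hout, numTerms_encode]
      exact hf
    · have hM : Consistent n (sampleBound args) Z Y M f := by
        refine hcons ?_ ?_
        · rw [hk]
          exact exists_consistent hr hZY
        · rw [hl]
          exact count_shared_le D (fun p _ => hx p) fun p hp => (hZY p hp).2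
      rw [hout] at hh
      exact fun p hp => hM.eq_label hh hZY hp

end ParamPAC

theorem mainTheorem4 (b : Bool) :
    ParamPAC.learningTermDNF b ∈ ParamPAC.FPTPACTime ∧
      ParamPAC.learningClauseCNF b ∈ ParamPAC.FPTPACTime :=
  ⟨ParamPAC.learningFormulas_mem false b, ParamPAC.learningFormulas_mem true b⟩
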